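/- Let $p$ be a prime, $T$ a finite abelian $p$-group and $\psi:T\to\mathbb R/\mathbb Z$ a quadratic function: $\psi(ax)=a^2\psi(x)$ for all $a\in\mathbb Z$, $x\in T$, and $b(x,y)=\psi(x+y)-\psi(x)-\psi(y)$ is bilinear. (Since $T$ is finite, $\psi$ takes its values in $\mathbb Q/\mathbb Z$.) Let $T^\perp=\{t\in T: b(t,s)=0\ \text{for all } s\in T\}$, assume that $\psi$ is tame, i.e. $\psi|_{T^\perp}=0$, and write $|T/T^\perp|=p^e$. For a finite abelian group $S$ and a function $f:S\to\mathbb R/\mathbb Z$ put $G(f)=\sum_{s\in S}e^{2\pi i f(s)}$ and, if $G(f)\neq0$, define the phase $\beta(f)\in\mathbb R/\mathbb Z$ by $G(f)=|G(f)|\,e^{2\pi i\beta(f)}$. Let $V$ be a free abelian group of finite rank and $B:V\times V\to\mathbb Z$ a symmetric bilinear form whose determinant $\det B$ (that of its matrix in a basis of $V$) is prime to $p$. Let $B\otimes\psi:V\otimes T\to\mathbb R/\mathbb Z$ be the quadratic function with $(B\otimes\psi)(v\otimes x)=B(v,v)\psi(x)$ and associated bilinear form $B\otimes b$. For $a$ prime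 to $p$ let $\varepsilon_p(a)\in\{0,1\}$. For odd $p$, $\varepsilon_p(a)=0$ if and only if $a$ is a quadratic residue modulo $p$; and $\varepsilon_2(a)=0$ if and only if $a\equiv\pm1\pmod 8$. Two integer matrices $A,C$ of the same size are $8$-similar if $C\equiv M^{\mathrm{tr}}AM\pmod 8$ for an integer matrix $M$ with $\det M$ odd. A matrix is reduced if, up to the numbering of the basis, it is an orthogonal sum of $1\times1$ matrices and matrices $\begin{pmatrix}2m_1&1\\1&2m_2\end{pmatrix}$ with $m_1,m_2\in\mathbb Z$. Define $\sigma_p(B)\in\mathbb Z/8$ as the class of $\operatorname{rank}B$ if $p$ is odd, and, if $p=2$, as the class of $N_1-N_{-1}+3N_3-3N_{-3}$, where $N_i$ is the number of diagonal entries congruent to $i$ modulo $8$ in any reduced matrix that is $8$-similar to the matrix of $B$. Then $\sigma_2(B)$ is well defined when $p=2$: such a reduced matrix exists, and all of them give the same value modulo $8$. Moreover $G(\psi)\ne0$ and $G(B\otimes\psi)\neq0$, so that both phases are defined, and for every integer representing $\sigma_p(B)$ modulo $8$ (again written $\sigma_p(B)$) $$\beta(B\otimes\psi)=\sigma_p(B)\cdot\beta(\psi)+\frac{\varepsilon_p(\det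 B)\cdot e}{2}\quad\text{in }\mathbb R/\mathbb Z .$$ -/

import Mathlib

open scoped TensorProduct

noncomputable section

namespace GaussSum

/-!
`UnitAddCircle = ℝ / ℤ`.  For an abelian group `T`, a quadratic function `T → ℝ / ℤ` is a
`QuadraticMap ℤ T UnitAddCircle`: `ψ (a • x) = (a * a) • ψ x` for all integers `a`, and
`QuadraticMap.polar ψ x y = ψ (x + y) - ψ x - ψ y` is bilinear in `x` and `y`.
-/

section GaussSums

variable {T : Type*}

/-- The Gauss sum `∑_{t ∈ T} exp (2 π i f t)` of a function on a finite set. -/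
def gaussSum [Finite T] (f : T → UnitAddCircle) : ℂ :=
  letI := Fintype.ofFinite T
  ∑ t : T, (AddCircle.toCircle (f t) : ℂ)

/-- The phase `β ∈ ℝ / ℤ` of the Gauss sum, `G = |G| exp (2 π i β)`
(it is meaningful when `G ≠ 0`). -/
def phase [Finite T] (f : T → UnitAddCircle) : UnitAddCircle :=
  ((Complex.arg (gaussSum f) / (2 * Real.pi) : ℝ) : UnitAddCircle)

/-- The defining property of the phase. -/
theorem gaussSum_eq_norm_mul_phase [Finite T] (f : T → UnitAddCircle) :
    gaussSum f = (‖gaussSum f‖ : ℂ) * (AddCircle.toCircle (phase f) : ℂ) := by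
  have h : (AddCircle.toCircle (phase f) : ℂ) =
      Complex.exp (Complex.arg (gaussSum f) * Complex.I) := by
    rw [phase, AddCircle.toCircle_apply_mk, Circle.coe_exp]
    congr 2
    have : (2 * Real.pi / 1 * (Complex.arg (gaussSum f) / (2 * Real.pi)) : ℝ) =
        Complex.arg (gaussSum f) := by
      field_simp
    exact_mod_cast this
  rw [h, Complex.norm_mul_exp_arg_mul_I]

end GaussSums

section Quadratic

variable {T : Type*} [AddCommGroup T]

/-- `T^⊥ = {t | b(t, s) = 0 for all s}`, where `b` is the associated bilinear form of `ψ`. -/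
def perp (ψ : QuadraticMap ℤ T UnitAddCircle) : AddSubgroup T where
  carrier := {t | ∀ s, QuadraticMap.polar ψ t s = 0}
  zero_mem' := fun s => QuadraticMap.polar_zero_left ψ s
  add_mem' := fun {a b} ha hb s => by
    rw [QuadraticMap.polar_add_left, ha s, hb s, add_zero]
  neg_mem' := fun {a} ha s => by
    rw [QuadraticMap.polar_neg_left, ha s, neg_zero]

/-- `ψ` is tame if it vanishes on `T^⊥`. -/
def IsTame (ψ : QuadraticMap ℤ T UnitAddCircle) : Prop :=
  ∀ t ∈ perp ψ, ψ t = 0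

end Quadratic

section Tensor

variable {V : Type*} [AddCommGroup V] [Module.Free ℤ V] [Module.Finite ℤ V]
variable {T : Type*} [AddCommGroup T]

instance finite_tensor [Finite T] : Finite (V ⊗[ℤ] T) :=
  Finite.of_equiv _
    ((TensorProduct.equivFinsuppOfBasisLeft (N := T) (Module.finBasis ℤ V)).toEquiv.trans
      Finsupp.equivFunOnFinite).symm

/-- The `i`-th coordinate map `V ⊗ T → T` with respect to a fixed basis of `V`. -/
def coordMap (V T : Type*) [AddCommGroup V] [Module.Free ℤ V] [Module.Finite ℤ V]
    [AddCommGroup T] (i : Fin (Module.finrank ℤ V)) : V ⊗[ℤ] T →ₗ[ℤ] T :=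
  (TensorProduct.lid ℤ T).toLinearMap ∘ₗ
    LinearMap.rTensor T ((Module.finBasis ℤ V).coord i)

theorem coordMap_tmul (i : Fin (Module.finrank ℤ V)) (v : V) (x : T) :
    coordMap V T i (v ⊗ₜ x) = (Module.finBasis ℤ V).repr v i • x := by
  change TensorProduct.lid ℤ T (LinearMap.rTensor T _ (v ⊗ₜ x)) = _
  rw [LinearMap.rTensor_tmul, TensorProduct.lid_tmul, Module.Basis.coord_apply]

/-- The quadratic function `B ⊗ ψ` on `V ⊗ T`.  For a basis `e` of `V` it is
`∑ i, e i ⊗ t i ↦ ∑ i, B (e i) (e i) ψ (t i) + ∑ i < j, B (e i) (e j) b (t i) (t j)`.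
For symmetric `B` it is the only quadratic function on `V ⊗ T` that satisfies
`(B ⊗ ψ) (v ⊗ x) = B (v, v) ψ x` and has associated bilinear form `B ⊗ b`: see
`tensorQuadratic_tmul`, `polar_tensorQuadratic_tmul` and `tensorQuadratic_unique`.
In particular it does not depend on the basis. -/
def tensorQuadratic (B : LinearMap.BilinForm ℤ V) (ψ : QuadraticMap ℤ T UnitAddCircle) :
    QuadraticMap ℤ (V ⊗[ℤ] T) UnitAddCircle :=
  ∑ i, B (Module.finBasis ℤ V i) (Module.finBasis ℤ V i) • ψ.comp (coordMap V T i) +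
  ∑ i, ∑ j ∈ Finset.Ioi i, B (Module.finBasis ℤ V i) (Module.finBasis ℤ V j) •
    LinearMap.BilinMap.toQuadraticMap
      (ψ.polarBilin.compl₁₂ (coordMap V T i) (coordMap V T j))

theorem tensorQuadratic_apply (B : LinearMap.BilinForm ℤ V)
    (ψ : QuadraticMap ℤ T UnitAddCircle) (z : V ⊗[ℤ] T) :
    tensorQuadratic B ψ z =
      ∑ i, B (Module.finBasis ℤ V i) (Module.finBasis ℤ V i) • ψ (coordMap V T i z) +
      ∑ i, ∑ j ∈ Finset.Ioi i, B (Module.finBasis ℤ V i) (Module.finBasis ℤ V j) •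
        QuadraticMap.polar ψ (coordMap V T i z) (coordMap V T j z) := by
  simp [tensorQuadratic]

theorem sum_sum_eq_diag_add_upper {n : ℕ} {A : Type*} [AddCommGroup A] (f : Fin n → Fin n → A) :
    ∑ i, ∑ j, f i j = ∑ i, f i i + ∑ i, ∑ j ∈ Finset.Ioi i, (f i j + f j i) := by
  have h := Finset.sum_sum_Ioi_add_eq_sum_sum_off_diag (fun i j => f j i)
  rw [h, ← Finset.sum_add_distrib]
  refine Finset.sum_congr rfl fun i _ => ?_
  rw [← Finset.sum_add_sum_compl {i}, Finset.sum_singleton]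

theorem form_apply_eq_sum (B : LinearMap.BilinForm ℤ V) (v w : V) :
    B v w = ∑ i, ∑ j, (Module.finBasis ℤ V).repr v i * (Module.finBasis ℤ V).repr w j *
      B (Module.finBasis ℤ V i) (Module.finBasis ℤ V j) := by
  conv_lhs => rw [← (Module.finBasis ℤ V).sum_repr v, ← (Module.finBasis ℤ V).sum_repr w]
  simp only [map_sum, LinearMap.sum_apply, map_smul, LinearMap.smul_apply, smul_eq_mul]
  rw [Finset.sum_comm]
  refine Finset.sum_congr rfl fun i _ => ?_
  rw [Finset.mul_sum]
  refine Finset.sum_congr rfl fun j _ => ?_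
  ring

theorem tensorQuadratic_tmul (B : LinearMap.BilinForm ℤ V) (hB : B.IsSymm)
    (ψ : QuadraticMap ℤ T UnitAddCircle) (v : V) (x : T) :
    tensorQuadratic B ψ (v ⊗ₜ x) = B v v • ψ x := by
  rw [tensorQuadratic_apply, form_apply_eq_sum, sum_sum_eq_diag_add_upper]
  simp only [coordMap_tmul, QuadraticMap.map_smul, QuadraticMap.polar_smul_left,
    QuadraticMap.polar_smul_right, QuadraticMap.polar_self, add_smul, Finset.sum_smul]
  congr 1
  · refine Finset.sum_congr rfl fun i _ => ?_
    rw [smul_smul]; congr 1; ring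
  · refine Finset.sum_congr rfl fun i _ => Finset.sum_congr rfl fun j _ => ?_
    rw [hB.eq (Module.finBasis ℤ V j) (Module.finBasis ℤ V i), two_smul]
    simp only [smul_add, smul_smul]
    congr 2 <;> ring

theorem polar_tensorQuadratic_tmul (B : LinearMap.BilinForm ℤ V) (hB : B.IsSymm)
    (ψ : QuadraticMap ℤ T UnitAddCircle) (v w : V) (x y : T) :
    QuadraticMap.polar (tensorQuadratic B ψ) (v ⊗ₜ x) (w ⊗ₜ y) =
      B v w • QuadraticMap.polar ψ x y := by
  have key : ∀ z z' : V ⊗[ℤ] T, QuadraticMap.polar (tensorQuadratic B ψ) z z' =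
      ∑ i, B (Module.finBasis ℤ V i) (Module.finBasis ℤ V i) •
        QuadraticMap.polar ψ (coordMap V T i z) (coordMap V T i z') +
      ∑ i, ∑ j ∈ Finset.Ioi i, B (Module.finBasis ℤ V i) (Module.finBasis ℤ V j) •
        (QuadraticMap.polar ψ (coordMap V T i z) (coordMap V T j z') +
          QuadraticMap.polar ψ (coordMap V T i z') (coordMap V T j z)) := by
    intro z z'
    rw [QuadraticMap.polar, tensorQuadratic_apply, tensorQuadratic_apply, tensorQuadratic_apply,
      add_sub_add_comm, add_sub_add_comm]
    simp only [← Finset.sum_sub_distrib, ← smul_sub]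
    congr 1
    · simp only [map_add, QuadraticMap.polar]
    · refine Finset.sum_congr rfl fun i _ => Finset.sum_congr rfl fun j _ => ?_
      congr 1
      simp only [map_add, QuadraticMap.polar_add_left, QuadraticMap.polar_add_right]
      abel
  rw [key, form_apply_eq_sum, sum_sum_eq_diag_add_upper]
  simp only [coordMap_tmul, QuadraticMap.polar_smul_left,
    QuadraticMap.polar_smul_right, add_smul, Finset.sum_smul]
  congr 1
  · refine Finset.sum_congr rfl fun i _ => ?_
    simp only [smul_smul]; congr 1; ring
  · refine Finset.sum_congr rfl fun i _ => Finset.sum_congr rfl fun j _ => ?_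
    rw [hB.eq (Module.finBasis ℤ V j) (Module.finBasis ℤ V i), QuadraticMap.polar_comm ψ y x]
    simp only [smul_add, smul_smul]
    congr 2 <;> ring

theorem tensorQuadratic_unique (B : LinearMap.BilinForm ℤ V) (hB : B.IsSymm)
    (ψ : QuadraticMap ℤ T UnitAddCircle) (φ : QuadraticMap ℤ (V ⊗[ℤ] T) UnitAddCircle)
    (h₁ : ∀ v x, φ (v ⊗ₜ x) = B v v • ψ x)
    (h₂ : ∀ v w x y, QuadraticMap.polar φ (v ⊗ₜ x) (w ⊗ₜ y) =
      B v w • QuadraticMap.polar ψ x y) :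
    φ = tensorQuadratic B ψ := by
  have hp : ∀ a b, QuadraticMap.polar φ a b = QuadraticMap.polar (tensorQuadratic B ψ) a b := by
    intro a b
    induction a using TensorProduct.induction_on with
    | zero => rw [QuadraticMap.polar_zero_left, QuadraticMap.polar_zero_left]
    | add a a' ha ha' =>
      rw [QuadraticMap.polar_add_left, QuadraticMap.polar_add_left, ha, ha']
    | tmul v x =>
      induction b using TensorProduct.induction_on with
      | zero => rw [QuadraticMap.polar_zero_right, QuadraticMap.polar_zero_right]
      | add b b' hb hb' =>
        rw [QuadraticMap.polar_add_right, QuadraticMap.polar_add_right, hb, hb']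
      | tmul w y => rw [h₂, polar_tensorQuadratic_tmul B hB]
  ext z
  induction z using TensorProduct.induction_on with
  | zero => simp
  | tmul v x => rw [h₁, tensorQuadratic_tmul B hB]
  | add a b ha hb =>
    rw [QuadraticMap.map_add φ, QuadraticMap.map_add (tensorQuadratic B ψ), ha, hb, hp]

end Tensor

section Matrices

variable {ι : Type*} [Fintype ι] [DecidableEq ι]

/-- `B` is `p^r`-similar to `C`: there is an integer matrix `M` with `det M` prime to `p` and
`C ≡ Mᵀ B M` modulo `p^r`. -/
def Similar (p r : ℕ) (B C : Matrix ι ι ℤ) : Prop :=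
  ∃ M : Matrix ι ι ℤ, IsCoprime M.det (p : ℤ) ∧
    ∀ i j, C i j ≡ (M.transpose * B * M) i j [ZMOD ((p : ℤ) ^ r)]

/-- The pseudo-hyperbolic matrix `H_{a,b}`. -/
def pseudoHyperbolic (a b : ℤ) : Matrix (Fin 2) (Fin 2) ℤ :=
  !![2 * a, 1; 1, 2 * b]

/-- A matrix is reduced if, up to the numbering of the basis, it is an orthogonal sum of
rank one forms and pseudo-hyperbolics. -/
def IsReduced (C : Matrix ι ι ℤ) : Prop :=
  ∃ (m n : ℕ) (d : Fin m → ℤ) (a b : Fin n → ℤ) (f : ι ≃ Fin m ⊕ Fin 2 × Fin n),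
    C = (Matrix.fromBlocks (Matrix.diagonal d) 0 0
      (Matrix.blockDiagonal fun k => pseudoHyperbolic (a k) (b k))).submatrix f f

/-- The number `N_c` of diagonal entries congruent to `c` modulo `8`. -/
def diagCount (C : Matrix ι ι ℤ) (c : ℤ) : ℕ :=
  (Finset.univ.filter fun i => C i i ≡ c [ZMOD 8]).card

/-- `N_1 - N_{-1} + 3 N_3 - 3 N_{-3}` modulo `8`. -/
def diagSigma (C : Matrix ι ι ℤ) : ZMod 8 :=
  (diagCount C 1 : ZMod 8) - diagCount C (-1) + 3 * diagCount C 3 - 3 * diagCount C (-3)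

open Classical in
/-- The mod `8` integer `σ_p(A)` for `det A` prime to `p`: the rank of the form for odd `p`, and
`N_1 - N_{-1} + 3 N_3 - 3 N_{-3}` of some reduced matrix `8`-similar to `A` for `p = 2`.
(If there is no such reduced matrix the value is `0`; the theorem asserts that for odd `det A`
one exists and that all of them give the same value.) -/
def sigma (p : ℕ) (A : Matrix ι ι ℤ) : ZMod 8 :=
  if p = 2 then
    if h : ∃ C, IsReduced C ∧ Similar 2 3 A C then diagSigma h.choose else 0
  else
    (A.rank : ZMod 8)

open Classical in
/-- `ε_p(a) ∈ {0, 1}` for `a` prime to `p`.  For odd `p` it is `0` exactly when `a` is a quadratic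
residue modulo `p`; for `p = 2` it is `0` exactly when `a ≡ ±1` modulo `8`. -/
def epsilon (p : ℕ) (a : ℤ) : ℕ :=
  if p = 2 then
    if a ≡ 1 [ZMOD 8] ∨ a ≡ -1 [ZMOD 8] then 0 else 1
  else
    if IsSquare (a : ZMod p) then 0 else 1

end Matrices

end GaussSum

end

noncomputable section

namespace GaussSum

/-! ### Gauss sums: basic operations and absolute value. -/

section Sums

/-! The Gauss sum of `B ⊗ ψ` depends on the matrix of `B` only up to `p^r`-similarity once `p^r`
kills `T` and the values of `ψ` (`matSum_eq_of_similar`), and it turns orthogonal sums into products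
(`matSum_fromBlocks`). Over the local ring `ZMod (p ^ r)` a symmetric matrix with unit determinant
splits into rank one forms and pseudo-hyperbolics (`exists_similar_blockForm`), so only `⟨d⟩` and
`H_{a,b}` need to be evaluated. Explicit congruences between small forms then give relations between
Gauss sums, which fix every phase up to a sign; finding that sign is the arithmetic core.

For `p = 2`, write `g` for the direction of `G(ψ)`. The congruences `⟨1⟩^4 ~ ⟨7⟩^4`, `⟨3⟩^2 ~
⟨15⟩^2` and `⟨1⟩ ⊥ H_{1,1} ~ ⟨3, 3, 27⟩` give `g^8 = 1` and show that the sum of `H_{1,1}` is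
`±|T||T^⊥|`. The hexagonal form `H_{1,1}` has an automorphism of order three fixing only `0` in `V ⊗
T`, so its sum is `1` modulo `3`; as `|T||T^⊥| = 2^e |T^⊥|^2` is `(-1)^e` modulo `3`, the sign is
`(-1)^e` (`direction_matSum_hexagonal`). All odd `d` and all `H_{a,b}` follow.

For odd `p`, `⟨a⟩^2 ~ ⟨1⟩^2` gives `G(aψ) = ±G(ψ)`. If all `G(aψ)` with `a` prime to `p` agree,
averaging over `a` makes `G(ψ)` rational, so `|G(ψ)|^2 = p^e |T^⊥|^2` is a square and `e` is even.
This settles odd `e`; even `e` reduces to it by adding `x^2 / p` on `ZMod p`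
(`gaussSum_smul_odd_prime`).

That `σ_2` is well defined follows from the same formula for `x^2 / 8` on `ZMod 8`: there `e = 2`
removes the sign, and the phase is exactly `σ_2 / 8`. -/

theorem gaussSum_eq_sum {T : Type*} [Fintype T] (f : T → UnitAddCircle) :
    gaussSum f = ∑ t, (AddCircle.toCircle (f t) : ℂ) := by
  unfold gaussSum
  convert rfl

theorem gaussSum_comp_equiv {S T : Type*} [Finite S] [Finite T] (e : S ≃ T)
    (f : T → UnitAddCircle) : gaussSum (fun s => f (e s)) = gaussSum f := by
  have := Fintype.ofFinite S
  have := Fintype.ofFinite T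
  rw [gaussSum_eq_sum, gaussSum_eq_sum]
  exact Equiv.sum_comp e fun t => (AddCircle.toCircle (f t) : ℂ)

theorem gaussSum_neg {T : Type*} [Finite T] (f : T → UnitAddCircle) :
    gaussSum (fun t => -f t) = starRingEnd ℂ (gaussSum f) := by
  have := Fintype.ofFinite T
  rw [gaussSum_eq_sum, gaussSum_eq_sum, map_sum]
  refine Finset.sum_congr rfl fun t _ => ?_
  rw [AddCircle.toCircle_neg, Circle.coe_inv_eq_conj]

theorem gaussSum_prod {S T : Type*} [Finite S] [Finite T] (f : S → UnitAddCircle)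
    (g : T → UnitAddCircle) :
    gaussSum (fun z : S × T => f z.1 + g z.2) = gaussSum f * gaussSum g := by
  have := Fintype.ofFinite S
  have := Fintype.ofFinite T
  rw [gaussSum_eq_sum, gaussSum_eq_sum, gaussSum_eq_sum, Fintype.sum_mul_sum,
    Fintype.sum_prod_type]
  simp only [AddCircle.toCircle_add, Circle.coe_mul]

/-- The Gauss sum of a tame quadratic function has absolute value `√(|T| |T^⊥|)`. -/
theorem norm_gaussSum_sq {T : Type*} [AddCommGroup T] [Finite T]
    (ψ : QuadraticMap ℤ T UnitAddCircle) (hψ : IsTame ψ) :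
    ‖gaussSum ψ‖ ^ 2 = Nat.card T * Nat.card (perp ψ) := by
  classical
  have := Fintype.ofFinite T
  -- The character `b(h, ·)` is trivial exactly when `h ∈ T^⊥`; by orthogonality only those `h`
  -- survive in `|G|^2`, and there `ψ h = 0` by tameness.
  let χ : T → AddChar T ℂ := fun h =>
    { toFun := fun y => (AddCircle.toCircle (QuadraticMap.polar ψ h y) : ℂ)
      map_zero_eq_one' := by simp
      map_add_eq_mul' := fun x y => by
        rw [QuadraticMap.polar_add_right, AddCircle.toCircle_add, Circle.coe_mul] }
  have hχ : ∀ h y, χ h y = (AddCircle.toCircle (QuadraticMap.polar ψ h y) : ℂ) := fun _ _ => rfl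
  have hsum : ∀ h, (AddCircle.toCircle (ψ h) : ℂ) * ∑ y, χ h y =
      if h ∈ perp ψ then (Fintype.card T : ℂ) else 0 := by
    intro h
    split_ifs with hh
    · rw [hψ h hh]
      have : ∀ y, χ h y = 1 := fun y => by rw [hχ, hh y]; simp
      simp [this]
    · have : χ h ≠ 0 := by
        intro h0
        apply hh
        intro s
        have h1 : χ h s = 1 := by rw [h0]; rfl
        rw [hχ] at h1
        apply AddCircle.injective_toCircle one_ne_zero
        rw [AddCircle.toCircle_zero]
        exact Circle.coe_eq_one.mp h1
      rw [AddChar.sum_eq_zero_iff_ne_zero.mpr this, mul_zero]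
  have key : (gaussSum ψ) * starRingEnd ℂ (gaussSum ψ) =
      ((Fintype.card T * Nat.card (perp ψ) : ℕ) : ℂ) := by
    rw [← gaussSum_neg, gaussSum_eq_sum, gaussSum_eq_sum, Finset.sum_mul_sum, Finset.sum_comm]
    calc _ = ∑ y, ∑ h, (AddCircle.toCircle (ψ h) : ℂ) * χ h y := by
          refine Finset.sum_congr rfl fun y _ => ?_
          -- Substituting `x = h + y` turns `ψ x - ψ y` into `ψ h + b(h, y)`.
          rw [← Equiv.sum_comp (Equiv.addRight y)]
          refine Finset.sum_congr rfl fun h _ => ?_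
          rw [← Circle.coe_mul, ← AddCircle.toCircle_add, hχ, ← Circle.coe_mul,
            ← AddCircle.toCircle_add, QuadraticMap.polar]
          congr 2
          simp only [Equiv.coe_addRight]
          abel
      _ = ∑ h, if h ∈ perp ψ then (Fintype.card T : ℂ) else 0 := by
          rw [Finset.sum_comm]
          refine Finset.sum_congr rfl fun h _ => ?_
          rw [← hsum, Finset.mul_sum]
      _ = _ := by
          rw [Finset.sum_ite, Finset.sum_const_zero, add_zero, Finset.sum_const,
            ← Fintype.card_subtype, Nat.card_eq_fintype_card]
          simp [mul_comm]
  rw [Complex.mul_conj'] at key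
  rw [Nat.card_eq_fintype_card]
  exact_mod_cast key

theorem gaussSum_ne_zero {T : Type*} [AddCommGroup T] [Finite T]
    (ψ : QuadraticMap ℤ T UnitAddCircle) (hψ : IsTame ψ) : gaussSum ψ ≠ 0 := by
  intro h
  have := norm_gaussSum_sq ψ hψ
  rw [h, norm_zero, zero_pow two_ne_zero] at this
  have h1 : (Nat.card T * Nat.card (perp ψ) : ℝ) ≠ 0 := by
    have := Nat.card_pos (α := T)
    have := Nat.card_pos (α := perp ψ)
    positivity
  exact h1 this.symm

end Sums

/-! ### Functoriality of `B ⊗ ψ` in `B`. -/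

section Functoriality

variable {V W : Type*} [AddCommGroup V] [Module.Free ℤ V] [Module.Finite ℤ V]
  [AddCommGroup W] [Module.Free ℤ W] [Module.Finite ℤ W]
variable {T : Type*} [AddCommGroup T]

/-- The pullback has the two properties that characterize `C ⊗ ψ`. The forms are compared only after
acting on values of `ψ`, so congruence modulo an exponent of these values suffices and `f` need not
be an isometry over `ℤ`. -/
theorem tensorQuadratic_comp_rTensor (B : LinearMap.BilinForm ℤ V) (hB : B.IsSymm)
    (C : LinearMap.BilinForm ℤ W) (hC : C.IsSymm) (f : W →ₗ[ℤ] V)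
    (ψ : QuadraticMap ℤ T UnitAddCircle)
    (h : ∀ x w y, B (f x) (f w) • ψ y = C x w • ψ y) (z : W ⊗[ℤ] T) :
    tensorQuadratic B ψ (f.rTensor T z) = tensorQuadratic C ψ z := by
  let F : W ⊗[ℤ] T →ₗ[ℤ] V ⊗[ℤ] T := (f.rTensor T).toAddMonoidHom.toIntLinearMap
  have hF : ∀ x y, F (x ⊗ₜ y) = f x ⊗ₜ y := fun x y => LinearMap.rTensor_tmul T f y x
  have : (tensorQuadratic B ψ).comp F = tensorQuadratic C ψ := by
    apply tensorQuadratic_unique C hC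
    · intro v x
      rw [QuadraticMap.comp_apply, hF, tensorQuadratic_tmul B hB, h]
    · intro v w x y
      have := polar_tensorQuadratic_tmul B hB ψ (f v) (f w) x y
      rw [QuadraticMap.polar] at this ⊢
      simp only [QuadraticMap.comp_apply, map_add, hF]
      rw [this, QuadraticMap.polar, smul_sub, smul_sub, smul_sub, smul_sub, h, h, h]
  rw [← this, QuadraticMap.comp_apply]
  rfl

theorem polar_tensorQuadratic_eq_zero (B : LinearMap.BilinForm ℤ V) (hB : B.IsSymm)
    {W W' : Type*} [AddCommGroup W] [AddCommGroup W'] (f : W →ₗ[ℤ] V) (g : W' →ₗ[ℤ] V)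
    (h : ∀ x y, B (f x) (g y) = 0) (ψ : QuadraticMap ℤ T UnitAddCircle)
    (z : W ⊗[ℤ] T) (z' : W' ⊗[ℤ] T) :
    QuadraticMap.polar (tensorQuadratic B ψ) (f.rTensor T z) (g.rTensor T z') = 0 := by
  induction z using TensorProduct.induction_on with
  | zero => rw [map_zero, QuadraticMap.polar_zero_left]
  | add a b ha hb => rw [map_add, QuadraticMap.polar_add_left, ha, hb, add_zero]
  | tmul v x =>
    induction z' using TensorProduct.induction_on with
    | zero => rw [map_zero, QuadraticMap.polar_zero_right]
    | add a b ha hb => rw [map_add, QuadraticMap.polar_add_right, ha, hb, add_zero]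
    | tmul w y =>
      rw [LinearMap.rTensor_tmul, LinearMap.rTensor_tmul, polar_tensorQuadratic_tmul B hB, h,
        zero_smul]

end Functoriality

/-! ### Gauss sums attached to integer matrices. -/

section MatrixSums

variable {T : Type*} [AddCommGroup T] [Finite T]
variable {ι κ : Type*} [Fintype ι] [DecidableEq ι] [Fintype κ] [DecidableEq κ]

/-- The Gauss sum of `A ⊗ ψ` for a symmetric integer matrix `A`. -/
def matSum (ψ : QuadraticMap ℤ T UnitAddCircle) (A : Matrix ι ι ℤ) : ℂ :=
  gaussSum (tensorQuadratic (Matrix.toBilin' A) ψ)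

theorem isSymm_toBilin' {A : Matrix ι ι ℤ} (hA : A.IsSymm) : (Matrix.toBilin' A).IsSymm := by
  refine ⟨fun x y => ?_⟩
  rw [Matrix.toBilin'_apply', Matrix.toBilin'_apply', Matrix.dotProduct_mulVec,
    ← Matrix.mulVec_transpose, hA.eq, dotProduct_comm]

theorem gaussSum_tensorQuadratic_eq_matSum {V : Type*} [AddCommGroup V] [Module.Free ℤ V]
    [Module.Finite ℤ V] (ψ : QuadraticMap ℤ T UnitAddCircle) (B : LinearMap.BilinForm ℤ V)
    (hB : B.IsSymm) (v : Module.Basis ι ℤ V) :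
    gaussSum (tensorQuadratic B ψ) = matSum ψ (LinearMap.BilinForm.toMatrix v B) := by
  have hA : (LinearMap.BilinForm.toMatrix v B).IsSymm := by
    ext i j
    simp [Matrix.transpose_apply, LinearMap.BilinForm.toMatrix_apply, hB.eq (v j) (v i)]
  have hs := isSymm_toBilin' hA
  let e := TensorProduct.congr v.equivFun (LinearEquiv.refl ℤ T)
  unfold matSum
  rw [← gaussSum_comp_equiv e.toEquiv]
  congr 1
  ext z
  symm
  have h := tensorQuadratic_comp_rTensor _ hs B hB v.equivFun.toLinearMap ψ (fun x w y => by
    congr 1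
    conv_rhs => rw [← Matrix.toBilin_toMatrix v B]
    rw [Matrix.toBilin'_apply, Matrix.toBilin_apply]
    rfl) z
  exact h

/-- The two summands are orthogonal for `B ⊗ b`, so the quadratic function is a sum of functions of
independent variables. -/
theorem matSum_fromBlocks (ψ : QuadraticMap ℤ T UnitAddCircle) {A : Matrix ι ι ℤ}
    {D : Matrix κ κ ℤ} (hA : A.IsSymm) (hD : D.IsSymm) :
    matSum ψ (Matrix.fromBlocks A 0 0 D) = matSum ψ A * matSum ψ D := by
  have hs : (Matrix.fromBlocks A 0 0 D).IsSymm := hA.fromBlocks (by simp) hD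
  have hs' := isSymm_toBilin' hs
  let E := LinearEquiv.sumArrowLequivProdArrow ι κ ℤ ℤ
  let i₁ : (ι → ℤ) →ₗ[ℤ] (ι ⊕ κ → ℤ) := E.symm.toLinearMap ∘ₗ LinearMap.inl ℤ _ _
  let i₂ : (κ → ℤ) →ₗ[ℤ] (ι ⊕ κ → ℤ) := E.symm.toLinearMap ∘ₗ LinearMap.inr ℤ _ _
  let p₁ : (ι ⊕ κ → ℤ) →ₗ[ℤ] (ι → ℤ) := LinearMap.fst ℤ _ _ ∘ₗ E.toLinearMap
  let p₂ : (ι ⊕ κ → ℤ) →ₗ[ℤ] (κ → ℤ) := LinearMap.snd ℤ _ _ ∘ₗ E.toLinearMap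
  have h11 : p₁ ∘ₗ i₁ = LinearMap.id := by ext; simp [p₁, i₁, E]
  have h12 : p₁ ∘ₗ i₂ = 0 := by ext; simp [p₁, i₂, E]
  have h21 : p₂ ∘ₗ i₁ = 0 := by ext; simp [p₂, i₁, E]
  have h22 : p₂ ∘ₗ i₂ = LinearMap.id := by ext; simp [p₂, i₂, E]
  have hid : i₁ ∘ₗ p₁ + i₂ ∘ₗ p₂ = LinearMap.id := by
    refine LinearMap.ext fun x => E.injective ?_
    simp [p₁, p₂, i₁, i₂]
  let e : ((ι → ℤ) ⊗[ℤ] T × (κ → ℤ) ⊗[ℤ] T) ≃ ((ι ⊕ κ → ℤ) ⊗[ℤ] T) :=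
    { toFun := fun z => i₁.rTensor T z.1 + i₂.rTensor T z.2
      invFun := fun z => (p₁.rTensor T z, p₂.rTensor T z)
      left_inv := by
        rintro ⟨z, w⟩
        simp [← LinearMap.comp_apply, ← LinearMap.rTensor_comp, h11, h12, h21, h22]
      right_inv := by
        intro z
        change ((i₁.rTensor T) ∘ₗ (p₁.rTensor T) + (i₂.rTensor T) ∘ₗ (p₂.rTensor T)) z = z
        rw [← LinearMap.rTensor_comp, ← LinearMap.rTensor_comp, ← LinearMap.rTensor_add, hid]
        simp }
  have hi₁ : ∀ x, i₁ x = Sum.elim x (fun _ => 0) := fun x => rfl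
  have hi₂ : ∀ x, i₂ x = Sum.elim (fun _ => 0) x := fun x => rfl
  unfold matSum
  rw [← gaussSum_prod, ← gaussSum_comp_equiv e]
  congr 1
  ext z
  change tensorQuadratic _ ψ (i₁.rTensor T z.1 + i₂.rTensor T z.2) = _
  rw [QuadraticMap.map_add (tensorQuadratic _ ψ),
    polar_tensorQuadratic_eq_zero _ hs' i₁ i₂, add_zero]
  · congr 1
    · refine tensorQuadratic_comp_rTensor _ hs' _ (isSymm_toBilin' hA) i₁ ψ (fun x w y => ?_) _
      rw [Matrix.toBilin'_apply, Matrix.toBilin'_apply, hi₁, hi₁]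
      simp
    · refine tensorQuadratic_comp_rTensor _ hs' _ (isSymm_toBilin' hD) i₂ ψ (fun x w y => ?_) _
      rw [Matrix.toBilin'_apply, Matrix.toBilin'_apply, hi₂, hi₂]
      simp
  · intro x y
    rw [Matrix.toBilin'_apply, hi₁, hi₂]
    simp

/-- Gauss sums of `p^r`-similar matrices agree if `p^r` kills `T` and `ψ`. -/
theorem matSum_eq_of_similar (ψ : QuadraticMap ℤ T UnitAddCircle) {p r : ℕ}
    (hT : ∀ x : T, ((p : ℤ) ^ r) • x = 0) (hψ : ∀ x : T, ((p : ℤ) ^ r) • ψ x = 0)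
    {A C : Matrix ι ι ℤ} (hA : A.IsSymm) (hC : C.IsSymm) (h : Similar p r A C) :
    matSum ψ A = matSum ψ C := by
  obtain ⟨M, hM, hMC⟩ := h
  let F := (Matrix.toLin' M).rTensor T
  have hinj : Function.Injective F := by
    rw [← LinearMap.ker_eq_bot, LinearMap.ker_eq_bot']
    intro z hz
    -- The adjugate shows that `det M` kills the kernel, and so does `p^r`; the two are coprime.
    have hz1 : M.det • z = 0 := by
      have h1 : (Matrix.toLin' M.adjugate).rTensor T (F z) = M.det • z := by
        change ((Matrix.toLin' M.adjugate).rTensor T ∘ₗ (Matrix.toLin' M).rTensor T) z = _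
        rw [← LinearMap.rTensor_comp, ← Matrix.toLin'_mul, Matrix.adjugate_mul, map_smul,
          Matrix.toLin'_one, LinearMap.rTensor_smul, LinearMap.rTensor_id]
        rfl
      rw [← h1, hz, map_zero]
    have hz2 : ((p : ℤ) ^ r) • z = 0 := by
      clear hz hz1
      induction z using TensorProduct.induction_on with
      | zero => rw [smul_zero]
      | tmul v x => rw [← TensorProduct.tmul_smul, hT, TensorProduct.tmul_zero]
      | add a b ha hb => rw [smul_add, ha, hb, add_zero]
    obtain ⟨a, b, hab⟩ := hM.pow_right (n := r)
    rw [← one_smul ℤ z, ← hab, add_smul, mul_smul, mul_smul, hz1, hz2, smul_zero, smul_zero,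
      add_zero]
  let e : ((ι → ℤ) ⊗[ℤ] T) ≃ ((ι → ℤ) ⊗[ℤ] T) :=
    Equiv.ofBijective F (Finite.injective_iff_bijective.mp hinj)
  unfold matSum
  rw [← gaussSum_comp_equiv e]
  congr 1
  ext z
  refine tensorQuadratic_comp_rTensor _ (isSymm_toBilin' hA) _ (isSymm_toBilin' hC) _ ψ ?_ z
  intro x w y
  rw [← sub_eq_zero, ← sub_smul]
  have hd : ((p : ℤ) ^ r) ∣ Matrix.toBilin' A (Matrix.toLin' M x) (Matrix.toLin' M w) -
      Matrix.toBilin' C x w := by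
    have h1 : Matrix.toBilin' A (Matrix.toLin' M x) (Matrix.toLin' M w) =
        Matrix.toBilin' (M.transpose * A * M) x w := by
      simp only [Matrix.toBilin'_apply', Matrix.toLin'_apply, ← Matrix.mulVec_mulVec,
        Matrix.dotProduct_mulVec, Matrix.vecMul_transpose]
    rw [h1, Matrix.toBilin'_apply, Matrix.toBilin'_apply, ← Finset.sum_sub_distrib]
    refine Finset.dvd_sum fun i _ => ?_
    rw [← Finset.sum_sub_distrib]
    refine Finset.dvd_sum fun j _ => ?_
    rw [← sub_mul, ← mul_sub]
    exact ((hMC i j).dvd.mul_left _).mul_right _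
  obtain ⟨k, hk⟩ := hd
  rw [hk, mul_comm, mul_smul, hψ, smul_zero]

theorem matSum_submatrix (ψ : QuadraticMap ℤ T UnitAddCircle) {A : Matrix ι ι ℤ}
    (hA : A.IsSymm) (f : κ ≃ ι) : matSum ψ (A.submatrix f f) = matSum ψ A := by
  have hs : (A.submatrix f f).IsSymm := hA.submatrix f
  let e := TensorProduct.congr (LinearEquiv.funCongrLeft ℤ ℤ f.symm) (LinearEquiv.refl ℤ T)
  unfold matSum
  rw [← gaussSum_comp_equiv e.toEquiv]
  congr 1
  ext z
  symm
  refine tensorQuadratic_comp_rTensor _ (isSymm_toBilin' hA) _ (isSymm_toBilin' hs)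
    (LinearEquiv.funCongrLeft ℤ ℤ f.symm).toLinearMap ψ ?_ z
  intro x w y
  congr 1
  rw [Matrix.toBilin'_apply, Matrix.toBilin'_apply]
  simp only [Matrix.submatrix_apply]
  rw [← Equiv.sum_comp f]
  refine Finset.sum_congr rfl fun i _ => ?_
  rw [← Equiv.sum_comp f]
  simp

theorem matSum_of_isEmpty [IsEmpty ι] (ψ : QuadraticMap ℤ T UnitAddCircle) (A : Matrix ι ι ℤ) :
    matSum ψ A = 1 := by
  have : Subsingleton ((ι → ℤ) ⊗[ℤ] T) :=
    (TensorProduct.equivFinsuppOfBasisLeft (N := T) (Pi.basisFun ℤ ι)).subsingleton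
  have := Fintype.ofFinite ((ι → ℤ) ⊗[ℤ] T)
  rw [matSum, gaussSum_eq_sum, Fintype.sum_subsingleton _ 0]
  simp

theorem matSum_of_unique [Unique ι] (ψ : QuadraticMap ℤ T UnitAddCircle) (A : Matrix ι ι ℤ) :
    matSum ψ A = gaussSum (fun x => A default default • ψ x) := by
  have hA : A.IsSymm := by ext i j; rw [Subsingleton.elim i j, Matrix.transpose_apply]
  let e : (ι → ℤ) ⊗[ℤ] T ≃ₗ[ℤ] T :=
    TensorProduct.congr (LinearEquiv.funUnique ι ℤ ℤ) (LinearEquiv.refl ℤ T) ≪≫ₗ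
      TensorProduct.lid ℤ T
  rw [matSum, ← gaussSum_comp_equiv e.symm.toEquiv]
  congr 1
  ext x
  have : e.symm x = (fun _ => 1) ⊗ₜ x := by
    rw [LinearEquiv.symm_apply_eq]
    exact (one_smul ℤ x).symm
  change tensorQuadratic _ ψ (e.symm x) = _
  rw [this, tensorQuadratic_tmul _ (isSymm_toBilin' hA), Matrix.toBilin'_apply]
  simp

end MatrixSums

/-! ### Decomposition of symmetric matrices over a local ring. -/

section Congruence

variable {R : Type*} [CommRing R]
variable {ι κ : Type*} [Fintype ι] [DecidableEq ι] [Fintype κ] [DecidableEq κ]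

/-- Congruence of matrices over a commutative ring. -/
def MatCongr (A C : Matrix ι ι R) : Prop :=
  ∃ M : Matrix ι ι R, IsUnit M.det ∧ C = M.transpose * A * M

theorem MatCongr.refl (A : Matrix ι ι R) : MatCongr A A := ⟨1, by simp, by simp⟩

theorem MatCongr.of_eq {A C : Matrix ι ι R} (h : A = C) : MatCongr A C := h ▸ .refl A

theorem MatCongr.trans {A C D : Matrix ι ι R} (h : MatCongr A C) (h' : MatCongr C D) :
    MatCongr A D := by
  obtain ⟨M, hM, rfl⟩ := h
  obtain ⟨N, hN, rfl⟩ := h'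
  refine ⟨M * N, by rw [Matrix.det_mul]; exact hM.mul hN, ?_⟩
  simp only [Matrix.transpose_mul, Matrix.mul_assoc]

theorem MatCongr.fromBlocks {A C : Matrix ι ι R} {A' C' : Matrix κ κ R} (h : MatCongr A C)
    (h' : MatCongr A' C') :
    MatCongr (Matrix.fromBlocks A 0 0 A') (Matrix.fromBlocks C 0 0 C') := by
  obtain ⟨M, hM, rfl⟩ := h
  obtain ⟨N, hN, rfl⟩ := h'
  refine ⟨Matrix.fromBlocks M 0 0 N, ?_, ?_⟩
  · rw [Matrix.det_fromBlocks_zero₂₁]; exact hM.mul hN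
  · simp [Matrix.fromBlocks_transpose, Matrix.fromBlocks_multiply]

theorem MatCongr.submatrix {A C : Matrix ι ι R} (h : MatCongr A C) (f : κ ≃ ι) :
    MatCongr (A.submatrix f f) (C.submatrix f f) := by
  obtain ⟨M, hM, rfl⟩ := h
  refine ⟨M.submatrix f f, by rwa [Matrix.det_submatrix_equiv_self], ?_⟩
  rw [Matrix.transpose_submatrix, Matrix.submatrix_mul_equiv, Matrix.submatrix_mul_equiv]

theorem MatCongr.isUnit_det {A C : Matrix ι ι R} (h : MatCongr A C) (hA : IsUnit A.det) :
    IsUnit C.det := by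
  obtain ⟨M, hM, rfl⟩ := h
  rw [Matrix.det_mul, Matrix.det_mul, Matrix.det_transpose]
  exact (hM.mul hA).mul hM

/-- Splitting off a nonsingular block of a symmetric matrix. -/
theorem MatCongr.schur {U : Matrix κ κ R} {X : Matrix κ ι R} {D : Matrix ι ι R}
    (hU : U.IsSymm) (hu : IsUnit U.det) :
    MatCongr (Matrix.fromBlocks U X X.transpose D)
      (Matrix.fromBlocks U 0 0 (D - X.transpose * U⁻¹ * X)) := by
  have hUt : (U⁻¹).transpose = U⁻¹ := by rw [Matrix.transpose_nonsing_inv, hU.eq]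
  -- Block Gram–Schmidt: project the second summand along the first.
  refine ⟨Matrix.fromBlocks 1 (-(U⁻¹ * X)) 0 1, by simp, ?_⟩
  simp only [Matrix.fromBlocks_transpose, Matrix.fromBlocks_multiply, Matrix.transpose_one,
    Matrix.transpose_zero, Matrix.transpose_neg, Matrix.transpose_mul, hUt]
  congr 1
  · simp
  · simp [Matrix.mul_nonsing_inv_cancel_left _ _ hu]
  · simp [Matrix.mul_assoc, Matrix.nonsing_inv_mul _ hu]
  · simp [Matrix.mul_assoc, Matrix.nonsing_inv_mul _ hu, sub_eq_add_neg, add_comm]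

/-- An orthogonal sum of rank one forms and pseudo-hyperbolics over a commutative ring. -/
def blockForm (d : ι → R) (a b : κ → R) : Matrix (ι ⊕ Fin 2 × κ) (ι ⊕ Fin 2 × κ) R :=
  Matrix.fromBlocks (Matrix.diagonal d) 0 0
    (Matrix.blockDiagonal fun k => !![2 * a k, 1; 1, 2 * b k])

/-- `A` is congruent to an orthogonal sum of nonsingular rank one forms and of
pseudo-hyperbolics with non-units on the diagonal. -/
def Decomposable (A : Matrix ι ι R) : Prop :=
  ∃ (m n : ℕ) (d : Fin m → R) (a b : Fin n → R) (f : ι ≃ Fin m ⊕ Fin 2 × Fin n),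
    (∀ i, IsUnit (d i)) ∧ (∀ k, ¬ IsUnit (2 * a k) ∧ ¬ IsUnit (2 * b k)) ∧
      MatCongr A ((blockForm d a b).submatrix f f)

theorem Decomposable.of_congr {A C : Matrix ι ι R} (h : MatCongr A C) (hC : Decomposable C) :
    Decomposable A := by
  obtain ⟨m, n, d, a, b, f, hd, hab, hc⟩ := hC
  exact ⟨m, n, d, a, b, f, hd, hab, h.trans hc⟩

theorem Decomposable.of_submatrix {A : Matrix ι ι R} (f : κ ≃ ι)
    (h : Decomposable (A.submatrix f f)) : Decomposable A := by
  obtain ⟨m, n, d, a, b, g, hd, hab, hc⟩ := h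
  refine ⟨m, n, d, a, b, f.symm.trans g, hd, hab, ?_⟩
  have := hc.submatrix f.symm
  rwa [Matrix.submatrix_submatrix, Matrix.submatrix_submatrix, f.self_comp_symm,
    Matrix.submatrix_id_id] at this

theorem Decomposable.of_blockForm {κ' μ' : Type*} [Fintype κ'] [DecidableEq κ'] [Fintype μ']
    [DecidableEq μ'] {A : Matrix ι ι R} (d : κ' → R) (a b : μ' → R) (f : ι ≃ κ' ⊕ Fin 2 × μ')
    (hd : ∀ i, IsUnit (d i)) (hab : ∀ k, ¬ IsUnit (2 * a k) ∧ ¬ IsUnit (2 * b k))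
    (h : MatCongr A ((blockForm d a b).submatrix f f)) : Decomposable A := by
  let e₁ := Fintype.equivFin κ'
  let e₂ := Fintype.equivFin μ'
  refine ⟨_, _, d ∘ e₁.symm, a ∘ e₂.symm, b ∘ e₂.symm,
    f.trans (Equiv.sumCongr e₁ (Equiv.prodCongr (Equiv.refl _) e₂)), fun i => hd _,
    fun k => hab _, ?_⟩
  convert h using 1
  ext i j
  simp only [Matrix.submatrix_apply, Equiv.trans_apply]
  rcases f i with i | ⟨i, k⟩ <;> rcases f j with j | ⟨j, l⟩ <;>
    simp [blockForm, Matrix.diagonal_apply, Matrix.blockDiagonal_apply]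

theorem Decomposable.fromBlocks_one {D : Matrix ι ι R} {U : Matrix (Fin 1) (Fin 1) R}
    (hU : IsUnit (U 0 0)) (hD : Decomposable D) :
    Decomposable (Matrix.fromBlocks U 0 0 D) := by
  obtain ⟨m, n, d, a, b, f, hd, hab, hc⟩ := hD
  refine of_blockForm (Sum.elim (fun _ : Fin 1 => U 0 0) d) a b
    ((Equiv.sumCongr (Equiv.refl _) f).trans (Equiv.sumAssoc _ _ _).symm) ?_ hab ?_
  · rintro (i | i)
    · exact hU
    · exact hd i
  · refine ((MatCongr.refl U).fromBlocks hc).trans (.of_eq ?_)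
    ext (i | i) (j | j)
    · fin_cases i; fin_cases j
      simp [blockForm]
    · simp only [Matrix.submatrix_apply, Equiv.trans_apply, Equiv.sumCongr_apply, Sum.map_inr,
        Sum.map_inl]
      rcases f j with j | ⟨j, l⟩ <;> simp [blockForm]
    · simp only [Matrix.submatrix_apply, Equiv.trans_apply, Equiv.sumCongr_apply, Sum.map_inr,
        Sum.map_inl]
      rcases f i with j | ⟨j, l⟩ <;> simp [blockForm]
    · simp only [Matrix.submatrix_apply, Equiv.trans_apply, Equiv.sumCongr_apply, Sum.map_inr,
        Matrix.fromBlocks_apply₂₂]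
      rcases f i with i | ⟨i, k⟩ <;> rcases f j with j | ⟨j, l⟩ <;>
        simp [blockForm, Matrix.diagonal_apply]

theorem Decomposable.fromBlocks_two {D : Matrix ι ι R} {x y : R} (hx : ¬ IsUnit (2 * x))
    (hy : ¬ IsUnit (2 * y)) (hD : Decomposable D) :
    Decomposable (Matrix.fromBlocks !![2 * x, 1; 1, 2 * y] 0 0 D) := by
  obtain ⟨m, n, d, a, b, f, hd, hab, hc⟩ := hD
  let E : Fin 2 ⊕ (Fin m ⊕ Fin 2 × Fin n) ≃ Fin m ⊕ Fin 2 × (Fin 1 ⊕ Fin n) :=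
    { toFun := Sum.elim (fun i => Sum.inr (i, Sum.inl 0))
        (Sum.elim Sum.inl (fun z => Sum.inr (z.1, Sum.inr z.2)))
      invFun := Sum.elim (fun i => Sum.inr (Sum.inl i))
        (fun z => Sum.elim (fun _ => Sum.inl z.1) (fun k => Sum.inr (Sum.inr (z.1, k))) z.2)
      left_inv := by rintro (i | i | ⟨i, j⟩) <;> rfl
      right_inv := by
        rintro (i | ⟨i, j | j⟩)
        · rfl
        · rw [Subsingleton.elim j 0]; rfl
        · rfl }
  refine of_blockForm d (Sum.elim (fun _ : Fin 1 => x) a) (Sum.elim (fun _ : Fin 1 => y) b)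
    ((Equiv.sumCongr (Equiv.refl _) f).trans E) hd ?_ ?_
  · rintro (i | i)
    · exact ⟨hx, hy⟩
    · exact hab i
  · refine ((MatCongr.refl _).fromBlocks hc).trans (.of_eq ?_)
    ext (i | i) (j | j)
    · simp [blockForm, E, Matrix.blockDiagonal_apply]
    · simp only [Matrix.submatrix_apply, Equiv.trans_apply, Equiv.sumCongr_apply, Sum.map_inr,
        Sum.map_inl]
      rcases f j with j | ⟨j, l⟩ <;> simp [blockForm, E, Matrix.blockDiagonal_apply]
    · simp only [Matrix.submatrix_apply, Equiv.trans_apply, Equiv.sumCongr_apply, Sum.map_inr,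
        Sum.map_inl]
      rcases f i with j | ⟨j, l⟩ <;> simp [blockForm, E, Matrix.blockDiagonal_apply]
    · simp only [Matrix.submatrix_apply, Equiv.trans_apply, Equiv.sumCongr_apply, Sum.map_inr,
        Matrix.fromBlocks_apply₂₂]
      rcases f i with i | ⟨i, k⟩ <;> rcases f j with j | ⟨j, l⟩ <;>
        simp [blockForm, E, Matrix.diagonal_apply, Matrix.blockDiagonal_apply]

/-- Splitting off the block of a symmetric matrix with indices in the range of `g`. -/
theorem exists_split {A : Matrix ι ι R} (hA : A.IsSymm) (hdet : IsUnit A.det) (g : κ → ι)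
    (hg : Function.Injective g) (hu : IsUnit (A.submatrix g g).det) :
    ∃ (f : κ ⊕ ((Set.range g)ᶜ : Set ι) ≃ ι)
      (D : Matrix ((Set.range g)ᶜ : Set ι) ((Set.range g)ᶜ : Set ι) R), D.IsSymm ∧
      IsUnit D.det ∧
      MatCongr (A.submatrix f f) (Matrix.fromBlocks (A.submatrix g g) 0 0 D) := by
  let f : κ ⊕ ((Set.range g)ᶜ : Set ι) ≃ ι :=
    (Equiv.sumCongr (Equiv.ofInjective g hg) (Equiv.refl _)).trans
      (Equiv.Set.sumCompl (Set.range g))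
  let X : Matrix κ ((Set.range g)ᶜ : Set ι) R := A.submatrix g Subtype.val
  let D₀ : Matrix ((Set.range g)ᶜ : Set ι) ((Set.range g)ᶜ : Set ι) R :=
    A.submatrix Subtype.val Subtype.val
  have hU : (A.submatrix g g).IsSymm := hA.submatrix g
  have hD₀ : D₀.IsSymm := hA.submatrix _
  have hf : A.submatrix f f = Matrix.fromBlocks (A.submatrix g g) X X.transpose D₀ := by
    ext (i | i) (j | j)
    · simp [f]
    · simp [f, X]
    · simp [f, X, hA.apply]
    · simp [f, D₀]
  have hc := MatCongr.schur (X := X) (D := D₀) hU hu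
  refine ⟨f, _, ?_, ?_, hf ▸ hc⟩
  · rw [Matrix.IsSymm, Matrix.transpose_sub, hD₀.eq]
    simp only [Matrix.transpose_mul, Matrix.transpose_transpose, Matrix.transpose_nonsing_inv,
      hU.eq, Matrix.mul_assoc]
  · have := hc.isUnit_det (by rw [← hf, Matrix.det_submatrix_equiv_self]; exact hdet)
    rw [Matrix.det_fromBlocks_zero₂₁] at this
    exact isUnit_of_mul_isUnit_right this

/-- A unit on the diagonal splits off as a rank one form. Otherwise some entry of any given row is a
unit `w`, because the determinant is nonzero in the residue field; the `2 × 2` block through it has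
determinant a non-unit minus `w^2`, hence a unit, and splits off as a pseudo-hyperbolic. The
complement again has unit determinant. -/
theorem decomposable_of_isUnit_det [IsLocalRing R] (h2 : ∀ x : R, ¬ IsUnit x → ∃ a, x = 2 * a)
    (n : ℕ) : ∀ {ι : Type*} [Fintype ι] [DecidableEq ι] (A : Matrix ι ι R),
      Fintype.card ι = n → A.IsSymm → IsUnit A.det → Decomposable A := by
  induction n using Nat.strong_induction_on with
  | _ n ih =>
  intro ι _ _ A hn hA hdet
  have ih' : ∀ {k : ℕ} (g : Fin (k + 1) → ι)
      (D : Matrix ((Set.range g)ᶜ : Set ι) ((Set.range g)ᶜ : Set ι) R), D.IsSymm →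
      IsUnit D.det → Decomposable D := by
    intro k g D hD hu
    refine ih _ ?_ D rfl hD hu
    rw [← hn]
    refine Fintype.card_lt_of_injective_of_notMem _ Subtype.val_injective (b := g 0) ?_
    simp
  by_cases hi : ∃ i, IsUnit (A i i)
  · obtain ⟨i, hi⟩ := hi
    obtain ⟨f, D, hD, hu, hc⟩ := exists_split hA hdet (fun _ : Fin 1 => i)
      (fun _ _ _ => Subsingleton.elim _ _) (by simpa using hi)
    exact .of_submatrix f (.of_congr hc (.fromBlocks_one (by simpa using hi) (ih' _ D hD hu)))
  · push Not at hi
    rcases isEmpty_or_nonempty ι with hι | ⟨⟨i⟩⟩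
    · refine ⟨0, 0, Fin.elim0, Fin.elim0, Fin.elim0, Equiv.equivOfIsEmpty _ _,
        fun i => i.elim0, fun i => i.elim0, ?_⟩
      convert MatCongr.refl A
      exact Subsingleton.elim _ _
    obtain ⟨j, hj⟩ : ∃ j, IsUnit (A i j) := by
      by_contra! hcon
      have h0 : (IsLocalRing.residue R) A.det = 0 := by
        rw [RingHom.map_det]
        refine Matrix.det_eq_zero_of_row_eq_zero i fun j => ?_
        simpa using hcon j
      exact (IsLocalRing.residue_ne_zero_iff_isUnit _).mpr hdet h0
    have hij : i ≠ j := by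
      rintro rfl
      exact hi i hj
    obtain ⟨w, hw⟩ := hj
    obtain ⟨a, ha⟩ := h2 _ (hi i)
    have hji : A j i = w := by rw [hw, hA.apply]
    -- Dividing the second basis vector by `w` makes the off-diagonal entry `1` and scales its
    -- diagonal entry by `w⁻²`.
    have hb' : ¬ IsUnit (A j j * (↑w⁻¹ * ↑w⁻¹)) := fun h =>
      hi j (isUnit_of_mul_isUnit_left h)
    obtain ⟨b, hb⟩ := h2 _ hb'
    have hsub : A.submatrix ![i, j] ![i, j] = !![A i i, w; w, A j j] := by
      ext x y
      fin_cases x <;> fin_cases y <;> simp [hw, hji]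
    have hud : IsUnit (A.submatrix ![i, j] ![i, j]).det := by
      rw [hsub, Matrix.det_fin_two_of]
      by_contra hcon
      have h1 : A i i * A j j ∈ IsLocalRing.maximalIdeal R :=
        Ideal.mul_mem_right _ _ ((IsLocalRing.mem_maximalIdeal _).mpr (hi i))
      have h3 := Ideal.sub_mem _ h1 ((IsLocalRing.mem_maximalIdeal _).mpr hcon)
      rw [sub_sub_cancel] at h3
      exact (IsLocalRing.mem_maximalIdeal _).mp h3 (w.isUnit.mul w.isUnit)
    obtain ⟨f, D, hD, hu, hc⟩ := exists_split hA hdet ![i, j]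
      (by intro x y; fin_cases x <;> fin_cases y <;> simp [hij, hij.symm]) hud
    refine .of_submatrix f (.of_congr hc (.of_congr
      (C := Matrix.fromBlocks !![2 * a, 1; 1, 2 * b] 0 0 D) (MatCongr.fromBlocks ?_ (.refl D))
      (.fromBlocks_two (ha ▸ hi i) (hb ▸ hb') (ih' _ D hD hu))))
    refine ⟨!![1, 0; 0, ↑w⁻¹], by simp, ?_⟩
    rw [hsub, ← ha, ← hb]
    ext x y
    fin_cases x <;> fin_cases y <;> (simp [Matrix.mul_apply, Fin.sum_univ_two]; try ring)

end Congruence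

/-! ### Passing between `ZMod (p ^ r)` and integer matrices. -/

section Reduction

theorem isUnit_intCast_zmod_pow {p r : ℕ} (hr : r ≠ 0) (z : ℤ) :
    IsUnit (z : ZMod (p ^ r)) ↔ IsCoprime z (p : ℤ) := by
  rw [ZMod.coe_int_isUnit_iff_isCoprime, isCoprime_comm, Nat.cast_pow,
    IsCoprime.pow_right_iff (Nat.pos_of_ne_zero hr)]

theorem not_isCoprime_iff_dvd {p : ℕ} (hp : p.Prime) (z : ℤ) :
    ¬ IsCoprime z (p : ℤ) ↔ (p : ℤ) ∣ z := by
  rw [isCoprime_comm, (Nat.prime_iff_prime_int.mp hp).coprime_iff_not_dvd, not_not]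

theorem isLocalRing_zmod_pow {p r : ℕ} (hp : p.Prime) (hr : r ≠ 0) :
    IsLocalRing (ZMod (p ^ r)) := by
  have : Fact (1 < p ^ r) := ⟨Nat.one_lt_pow hr hp.one_lt⟩
  refine IsLocalRing.of_nonunits_add fun a b ha hb => ?_
  obtain ⟨a, rfl⟩ := ZMod.intCast_surjective a
  obtain ⟨b, rfl⟩ := ZMod.intCast_surjective b
  rw [mem_nonunits_iff, isUnit_intCast_zmod_pow hr, not_isCoprime_iff_dvd hp] at ha hb
  rw [mem_nonunits_iff, ← Int.cast_add, isUnit_intCast_zmod_pow hr, not_isCoprime_iff_dvd hp]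
  exact dvd_add ha hb

/-- For `p = 2` the non-units are the even classes; for odd `p` the factor `2` is invertible. This
lets one decomposition serve both cases. -/
theorem exists_eq_two_mul_of_not_isUnit {p r : ℕ} (hp : p.Prime) (hr : r ≠ 0)
    (x : ZMod (p ^ r)) (hx : ¬ IsUnit x) : ∃ a, x = 2 * a := by
  rcases hp.eq_two_or_odd' with rfl | hodd
  · obtain ⟨x, rfl⟩ := ZMod.intCast_surjective x
    rw [isUnit_intCast_zmod_pow hr, not_isCoprime_iff_dvd hp] at hx
    obtain ⟨a, rfl⟩ := hx
    exact ⟨a, by push_cast; rfl⟩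
  · have h2 : IsUnit ((2 : ℤ) : ZMod (p ^ r)) := by
      rw [isUnit_intCast_zmod_pow hr]
      exact_mod_cast Nat.isCoprime_iff_coprime.mpr (Nat.coprime_two_left.mpr hodd)
    obtain ⟨u, hu⟩ := h2
    refine ⟨↑u⁻¹ * x, ?_⟩
    have : (2 : ZMod (p ^ r)) = u := by rw [hu]; norm_num
    rw [this, Units.mul_inv_cancel_left]

variable {ι κ : Type*} [Fintype ι] [DecidableEq ι] [Fintype κ] [DecidableEq κ]

theorem similar_of_matCongr {p r : ℕ} (hr : r ≠ 0) {A C : Matrix ι ι ℤ}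
    (h : MatCongr (A.map (Int.cast : ℤ → ZMod (p ^ r))) (C.map Int.cast)) : Similar p r A C := by
  obtain ⟨M, hM, hC⟩ := h
  choose N hN using fun i j => ZMod.intCast_surjective (M i j)
  let N' : Matrix ι ι ℤ := Matrix.of N
  have hNM : N'.map (Int.cast : ℤ → ZMod (p ^ r)) = M := by
    ext i j
    exact hN i j
  refine ⟨N', ?_, fun i j => ?_⟩
  · rw [← isUnit_intCast_zmod_pow hr]
    have := (Int.castRingHom (ZMod (p ^ r))).map_det N'
    rw [RingHom.mapMatrix_apply] at this
    change ((N'.det : ℤ) : ZMod (p ^ r)) = (N'.map (Int.cast : ℤ → ZMod (p ^ r))).det at this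
    rwa [this, hNM]
  · have h1 : (N'.transpose * A * N').map (Int.cast : ℤ → ZMod (p ^ r)) = C.map Int.cast := by
      rw [hC, ← hNM]
      exact (Matrix.map_mul (f := Int.castRingHom (ZMod (p ^ r)))).trans
        (congrArg (· * _) Matrix.map_mul)
    have h2 := congrFun (congrFun h1 i) j
    rw [Matrix.map_apply, Matrix.map_apply, ZMod.intCast_eq_intCast_iff] at h2
    exact_mod_cast h2.symm

theorem blockForm_isSymm {ι κ R : Type*} [DecidableEq ι] [DecidableEq κ] [CommRing R] (d : ι → R) (a b : κ → R) :
    (blockForm d a b).IsSymm := by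
  refine Matrix.IsSymm.fromBlocks (Matrix.isSymm_diagonal d) (by simp) ?_
  rw [Matrix.IsSymm, Matrix.blockDiagonal_transpose]
  congr 1
  ext k i j
  fin_cases i <;> fin_cases j <;> rfl

theorem det_blockForm {R : Type*} [CommRing R] (d : ι → R) (a b : κ → R) :
    (blockForm d a b).det = (∏ i, d i) * ∏ k, (4 * a k * b k - 1) := by
  rw [blockForm, Matrix.det_fromBlocks_zero₂₁, Matrix.det_diagonal, Matrix.det_blockDiagonal]
  congr 1
  refine Finset.prod_congr rfl fun k _ => ?_
  rw [Matrix.det_fin_two_of]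
  ring

/-- A symmetric matrix with determinant prime to `p` is `p^r`-similar to an orthogonal sum of
rank one forms and pseudo-hyperbolics. -/
theorem exists_similar_blockForm {p r : ℕ} (hp : p.Prime) (hr : r ≠ 0) {A : Matrix ι ι ℤ}
    (hA : A.IsSymm) (hdet : IsCoprime A.det (p : ℤ)) :
    ∃ (m n : ℕ) (d : Fin m → ℤ) (a b : Fin n → ℤ) (f : ι ≃ Fin m ⊕ Fin 2 × Fin n),
      (∀ i, IsCoprime (d i) (p : ℤ)) ∧ (∀ k, (p : ℤ) ∣ 2 * a k ∧ (p : ℤ) ∣ 2 * b k) ∧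
        Similar p r A ((blockForm d a b).submatrix f f) := by
  have := isLocalRing_zmod_pow hp hr
  have hdet' : IsUnit (A.map (Int.cast : ℤ → ZMod (p ^ r))).det := by
    have := (Int.castRingHom (ZMod (p ^ r))).map_det A
    rw [RingHom.mapMatrix_apply] at this
    change ((A.det : ℤ) : ZMod (p ^ r)) = (A.map (Int.cast : ℤ → ZMod (p ^ r))).det at this
    rwa [← this, isUnit_intCast_zmod_pow hr]
  obtain ⟨m, n, d, a, b, f, hd, hab, hc⟩ := decomposable_of_isUnit_det
    (exists_eq_two_mul_of_not_isUnit hp hr) _ _ rfl (hA.map _) hdet'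
  choose d' hd' using fun i => ZMod.intCast_surjective (d i)
  choose a' ha' using fun i => ZMod.intCast_surjective (a i)
  choose b' hb' using fun i => ZMod.intCast_surjective (b i)
  refine ⟨m, n, d', a', b', f, fun i => ?_, fun k => ?_, similar_of_matCongr hr ?_⟩
  · rw [← isUnit_intCast_zmod_pow hr, hd']
    exact hd i
  · rw [← not_isCoprime_iff_dvd hp, ← not_isCoprime_iff_dvd hp, ← isUnit_intCast_zmod_pow hr,
      ← isUnit_intCast_zmod_pow hr]
    push_cast
    rw [ha', hb']
    exact hab k
  · convert hc using 1
    ext i j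
    simp only [Matrix.submatrix_apply, Matrix.map_apply]
    rcases f i with i | ⟨i, k⟩ <;> rcases f j with j | ⟨j, l⟩
    · by_cases h : i = j <;> simp [blockForm, hd', h]
    · simp [blockForm]
    · simp [blockForm]
    · by_cases h : k = l
      · fin_cases i <;> fin_cases j <;> simp [blockForm, Matrix.blockDiagonal_apply, ha', hb', h]
      · simp [blockForm, Matrix.blockDiagonal_apply, h]

end Reduction

/-! ### Multiplicativity over the blocks of a reduced form. -/

section Products

variable {T : Type*} [AddCommGroup T] [Finite T]

theorem matSum_diagonal (ψ : QuadraticMap ℤ T UnitAddCircle) {m : ℕ} (d : Fin m → ℤ) :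
    matSum ψ (Matrix.diagonal d) = ∏ i, gaussSum (fun x => d i • ψ x) := by
  induction m with
  | zero => rw [matSum_of_isEmpty, Fin.prod_univ_zero]
  | succ m ih =>
    rw [← matSum_submatrix ψ (Matrix.isSymm_diagonal d)
      (finSumFinEquiv : Fin m ⊕ Fin 1 ≃ Fin (m + 1)), Fin.prod_univ_castSucc, ← ih]
    have : (Matrix.diagonal d).submatrix (finSumFinEquiv : Fin m ⊕ Fin 1 ≃ Fin (m + 1))
        finSumFinEquiv = Matrix.fromBlocks (Matrix.diagonal fun i => d i.castSucc) 0 0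
          (Matrix.diagonal fun _ => d (Fin.last m)) := by
      rw [Matrix.submatrix_diagonal_equiv, Matrix.fromBlocks_diagonal]
      congr 1
      ext (i | i)
      · rfl
      · rw [Subsingleton.elim i 0]; rfl
    rw [this, matSum_fromBlocks ψ (Matrix.isSymm_diagonal _) (Matrix.isSymm_diagonal _),
      matSum_of_unique (ι := Fin 1), Matrix.diagonal_apply_eq]

theorem matSum_blockDiagonal (ψ : QuadraticMap ℤ T UnitAddCircle) {n : ℕ}
    (N : Fin n → Matrix (Fin 2) (Fin 2) ℤ) (hN : ∀ k, (N k).IsSymm) :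
    matSum ψ (Matrix.blockDiagonal N) = ∏ k, matSum ψ (N k) := by
  have hs : ∀ {n : ℕ} (N : Fin n → Matrix (Fin 2) (Fin 2) ℤ) (_ : ∀ k, (N k).IsSymm),
      (Matrix.blockDiagonal N).IsSymm := by
    intro n N hN
    rw [Matrix.IsSymm, Matrix.blockDiagonal_transpose]
    exact congrArg _ (funext fun k => (hN k).eq)
  induction n with
  | zero => rw [matSum_of_isEmpty, Fin.prod_univ_zero]
  | succ n ih =>
    let E : Fin 2 × Fin n ⊕ Fin 2 ≃ Fin 2 × Fin (n + 1) :=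
      { toFun := Sum.elim (fun z => (z.1, z.2.castSucc)) (fun i => (i, Fin.last n))
        invFun := fun z => Fin.lastCases (Sum.inr z.1) (fun k => Sum.inl (z.1, k)) z.2
        left_inv := by rintro (⟨i, k⟩ | i) <;> simp
        right_inv := by
          rintro ⟨i, k⟩
          induction k using Fin.lastCases <;> simp }
    rw [← matSum_submatrix ψ (hs N hN) E, Fin.prod_univ_castSucc, ← ih _ fun k => hN _]
    have : (Matrix.blockDiagonal N).submatrix E E =
        Matrix.fromBlocks (Matrix.blockDiagonal fun k => N k.castSucc) 0 0 (N (Fin.last n)) := by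
      ext (⟨i, k⟩ | i) (⟨j, l⟩ | j)
      · simp [E, Matrix.blockDiagonal_apply]
      · simp [E, Matrix.blockDiagonal_apply, (Fin.castSucc_lt_last _).ne]
      · simp [E, Matrix.blockDiagonal_apply, (Fin.castSucc_lt_last _).ne']
      · simp [E, Matrix.blockDiagonal_apply]
    rw [this, matSum_fromBlocks ψ (hs _ fun k => hN _) (hN _)]

theorem pseudoHyperbolic_isSymm (a b : ℤ) : (pseudoHyperbolic a b).IsSymm := by
  ext i j
  fin_cases i <;> fin_cases j <;> rfl

theorem matSum_blockForm (ψ : QuadraticMap ℤ T UnitAddCircle) {m n : ℕ} (d : Fin m → ℤ)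
    (a b : Fin n → ℤ) :
    matSum ψ (blockForm d a b) = (∏ i, gaussSum (fun x => d i • ψ x)) *
      ∏ k, matSum ψ (pseudoHyperbolic (a k) (b k)) := by
  have hb : (Matrix.blockDiagonal fun k => pseudoHyperbolic (a k) (b k)).IsSymm := by
    rw [Matrix.IsSymm, Matrix.blockDiagonal_transpose]
    exact congrArg _ (funext fun k => (pseudoHyperbolic_isSymm _ _).eq)
  rw [← matSum_diagonal, ← matSum_blockDiagonal ψ _ fun k => pseudoHyperbolic_isSymm _ _,
    ← matSum_fromBlocks ψ (Matrix.isSymm_diagonal _) hb]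
  rfl

end Products

/-! ### Directions of complex numbers and rescaling of forms. -/

section Direction

/-- The point `z / |z|` of the unit circle. -/
def direction (z : ℂ) : ℂ := z / ‖z‖

theorem direction_mul (z w : ℂ) : direction (z * w) = direction z * direction w := by
  simp only [direction, norm_mul, Complex.ofReal_mul]
  ring

theorem direction_prod {α : Type*} (s : Finset α) (f : α → ℂ) :
    direction (∏ i ∈ s, f i) = ∏ i ∈ s, direction (f i) := by
  classical
  induction s using Finset.induction_on with
  | empty => simp [direction]
  | insert a s ha ih => rw [Finset.prod_insert ha, Finset.prod_insert ha, direction_mul, ih]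

theorem direction_pow (z : ℂ) (n : ℕ) : direction (z ^ n) = direction z ^ n := by
  simp only [direction, norm_pow, Complex.ofReal_pow, div_pow]

theorem direction_ne_zero {z : ℂ} (hz : z ≠ 0) : direction z ≠ 0 :=
  div_ne_zero hz (by simpa using hz)

theorem direction_conj {z : ℂ} (hz : z ≠ 0) :
    direction (starRingEnd ℂ z) = (direction z)⁻¹ := by
  have h : (‖z‖ : ℂ) ≠ 0 := by simpa using hz
  rw [direction, direction, Complex.norm_conj, inv_div, div_eq_div_iff h hz, mul_comm,
    Complex.mul_conj']
  ring

theorem norm_mul_direction (z : ℂ) : (‖z‖ : ℂ) * direction z = z := by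
  rcases eq_or_ne z 0 with rfl | hz
  · simp [direction]
  · rw [direction, mul_div_cancel₀]
    simpa using hz

theorem toCircle_phase {T : Type*} [Finite T] {f : T → UnitAddCircle} (h : gaussSum f ≠ 0) :
    (AddCircle.toCircle (phase f) : ℂ) = direction (gaussSum f) := by
  have h' : (‖gaussSum f‖ : ℂ) ≠ 0 := by simpa using h
  rw [direction, eq_div_iff h', mul_comm]
  exact (gaussSum_eq_norm_mul_phase f).symm

end Direction

section Scaling

variable {T : Type*} [AddCommGroup T] [Finite T]

theorem similar_of_eq {ι : Type*} [Fintype ι] [DecidableEq ι] {p r : ℕ} {A C : Matrix ι ι ℤ}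
    (M : Matrix ι ι ℤ) (hM : IsCoprime M.det (p : ℤ)) (h : C = M.transpose * A * M) :
    Similar p r A C := ⟨M, hM, fun i j => by rw [h]⟩

theorem gaussSum_smul_eq (ψ : QuadraticMap ℤ T UnitAddCircle) {p r : ℕ}
    (hT : ∀ x : T, ((p : ℤ) ^ r) • x = 0) (hψ : ∀ x : T, ((p : ℤ) ^ r) • ψ x = 0)
    {d d' c : ℤ} (hc : IsCoprime c (p : ℤ)) (h : d ≡ c ^ 2 * d' [ZMOD (p : ℤ) ^ r]) :
    gaussSum (fun x => d • ψ x) = gaussSum (fun x => d' • ψ x) := by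
  have := matSum_eq_of_similar ψ hT hψ (Matrix.isSymm_diagonal fun _ : Fin 1 => d')
    (Matrix.isSymm_diagonal fun _ : Fin 1 => d) ⟨Matrix.diagonal fun _ => c, by simpa using hc, by
      intro i j
      rw [Subsingleton.elim i 0, Subsingleton.elim j 0]
      simp only [Matrix.diagonal_transpose, Matrix.diagonal_mul_diagonal, Matrix.diagonal_apply_eq]
      convert h using 1
      ring⟩
  rw [matSum_diagonal, matSum_diagonal, Fin.prod_univ_one, Fin.prod_univ_one] at this
  exact this.symm

end Scaling

/-! ### Gauss sums modulo three. -/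

section Integrality

/-- If a map of order three preserves `f` and fixes only one point, at which `f` vanishes, then
the Gauss sum of `f` is congruent to `1` modulo `3`. -/
theorem isIntegral_gaussSum_sub_one_div_three {S : Type*} [Finite S] (f : S → UnitAddCircle)
    {N : ℕ} (hN : N ≠ 0) (hf : ∀ s, N • f s = 0) (F : S → S) (hF : ∀ s, F (F (F s)) = s)
    (hfF : ∀ s, f (F s) = f s) (s₀ : S) (hs₀ : f s₀ = 0) (hfix : ∀ s, F s = s ↔ s = s₀) :
    IsIntegral ℤ ((gaussSum f - 1) / 3) := by
  classical
  have := Fintype.ofFinite S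
  have hcard : ∀ c : UnitAddCircle, ∃ m : ℤ,
      -- Each level set is stable under the order three map, so its size is congruent modulo `3` to
      -- its number of fixed points.
      (Fintype.card {s // f s = c} : ℤ) = 3 * m + if c = 0 then 1 else 0 := by
    intro c
    let g : Function.End {s // f s = c} := fun s => ⟨F s, (hfF _).trans s.2⟩
    have hg : g ^ 3 ^ 1 = 1 := by
      funext s
      exact Subtype.ext (hF s)
    have : Fact (Nat.Prime 3) := ⟨Nat.prime_three⟩
    have h1 := Equiv.Perm.card_fixedPoints_modEq hg
    have h2 : Fintype.card g.fixedPoints = if c = 0 then 1 else 0 := by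
      split_ifs with hc
      · rw [Fintype.card_eq_one_iff]
        have hfx : g ⟨s₀, hs₀.trans hc.symm⟩ = ⟨s₀, hs₀.trans hc.symm⟩ :=
          Subtype.ext ((hfix s₀).mpr rfl)
        refine ⟨⟨⟨s₀, hs₀.trans hc.symm⟩, hfx⟩, ?_⟩
        rintro ⟨⟨s, hs⟩, h⟩
        have : F s = s := congrArg Subtype.val h
        exact Subtype.ext (Subtype.ext ((hfix s).mp this))
      · rw [Fintype.card_eq_zero_iff]
        refine ⟨?_⟩
        rintro ⟨⟨s, hs⟩, h⟩
        have : F s = s := congrArg Subtype.val h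
        rw [(hfix s).mp this, hs₀] at hs
        exact hc hs.symm
    rw [h2] at h1
    obtain ⟨m, hm⟩ := (Nat.modEq_iff_dvd.mp h1)
    refine ⟨-m, ?_⟩
    push_cast at hm
    linarith
  choose m hm using hcard
  have hsum : gaussSum f = 1 + 3 * ∑ c ∈ Finset.univ.image f, (m c : ℂ) * AddCircle.toCircle c := by
    rw [gaussSum_eq_sum]
    rw [← Finset.sum_fiberwise_of_maps_to (t := Finset.univ.image f) (g := f)
      (fun x _ => Finset.mem_image_of_mem _ (Finset.mem_univ x))]
    have h1 : (1 : ℂ) = ∑ c ∈ Finset.univ.image f, if c = 0 then 1 else 0 := by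
      rw [Finset.sum_ite_eq', if_pos (hs₀ ▸ Finset.mem_image_of_mem f (Finset.mem_univ s₀))]
    rw [h1, Finset.mul_sum, ← Finset.sum_add_distrib]
    refine Finset.sum_congr rfl fun c _ => ?_
    have h2 : ∀ s ∈ Finset.univ.filter (fun s => f s = c),
        (AddCircle.toCircle (f s) : ℂ) = AddCircle.toCircle c := by
      intro s hs
      rw [(Finset.mem_filter.mp hs).2]
    rw [Finset.sum_congr rfl h2, Finset.sum_const, ← Fintype.card_subtype, nsmul_eq_mul]
    have h3 := congrArg (Int.cast : ℤ → ℂ) (hm c)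
    push_cast at h3
    rw [h3]
    split_ifs with hc
    · simp [hc]; ring
    · ring
  have : (gaussSum f - 1) / 3 = ∑ c ∈ Finset.univ.image f, (m c : ℂ) * AddCircle.toCircle c := by
    rw [hsum]; ring
  rw [this]
  refine IsIntegral.sum _ fun c hc => IsIntegral.mul (isIntegral_algebraMap (x := m c)) ?_
  obtain ⟨s, -, rfl⟩ := Finset.mem_image.mp hc
  -- The values are `N`-th roots of unity, hence algebraic integers.
  refine IsIntegral.of_pow (Nat.pos_of_ne_zero hN) ?_
  rw [← Circle.coe_pow, ← AddCircle.toCircle_nsmul, hf, AddCircle.toCircle_zero, Circle.coe_one]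
  exact isIntegral_one

theorem dvd_of_isIntegral_div {a b : ℤ} (hb : b ≠ 0) (h : IsIntegral ℤ ((a : ℂ) / b)) : b ∣ a := by
  have h1 : IsIntegral ℤ ((a : ℚ) / b) := by
    rw [← isIntegral_algebraMap_iff (algebraMap ℚ ℂ).injective]
    simpa using h
  obtain ⟨c, hc⟩ := IsIntegrallyClosed.isIntegral_iff.mp h1
  refine ⟨c, ?_⟩
  have hb' : (b : ℚ) ≠ 0 := by exact_mod_cast hb
  rw [eq_div_iff hb'] at hc
  have : (a : ℚ) = b * c := by rw [← hc, mul_comm]; rfl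
  exact_mod_cast this

end Integrality

/-! ### Congruences of 2-adic forms and the resulting relations. -/

section TwoAdic

theorem exists_sq_modEq_two_pow {n : ℤ} (hn : n ≡ 1 [ZMOD 8]) (r : ℕ) :
    ∃ c : ℤ, IsCoprime c 2 ∧ c ^ 2 ≡ n [ZMOD 2 ^ r] := by
  obtain ⟨k, hk⟩ := hn.symm.dvd
  -- With `n = 1 + 8k`, the equation `(1 + 4z)^2 = n` becomes `z + 2z^2 = k`. The iteration `z ↦ k -
  -- 2z^2` gains one factor `2` per step.
  have key : ∃ z : ℤ, (2 : ℤ) ^ r ∣ z + 2 * z ^ 2 - k := by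
    induction r with
    | zero => exact ⟨0, by simp⟩
    | succ r ih =>
      obtain ⟨z, m, hm⟩ := ih
      refine ⟨k - 2 * z ^ 2, -m * (k - 2 * z ^ 2 + z), ?_⟩
      rw [pow_succ]
      linear_combination (-2) * (k - 2 * z ^ 2 + z) * hm
  obtain ⟨z, m, hm⟩ := key
  refine ⟨1 + 4 * z, ⟨1, -2 * z, by ring⟩, (Int.modEq_iff_dvd.mpr ⟨-8 * m, ?_⟩)⟩
  linear_combination hk - 8 * hm

variable {T : Type*} [AddCommGroup T] [Finite T] (ψ : QuadraticMap ℤ T UnitAddCircle)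

theorem isCoprime_two_iff (d : ℤ) : IsCoprime d 2 ↔ d % 2 = 1 := by
  rw [isCoprime_comm, Int.prime_two.coprime_iff_not_dvd]
  omega

theorem gaussSum_smul_eq_of_modEq_eight {r : ℕ} (hT : ∀ x : T, ((2 : ℕ) : ℤ) ^ r • x = 0)
    (hψ : ∀ x : T, ((2 : ℕ) : ℤ) ^ r • ψ x = 0) {d d' : ℤ} (hd : d' % 2 = 1)
    (h : d ≡ d' [ZMOD 8]) :
    gaussSum (fun x => d • ψ x) = gaussSum (fun x => d' • ψ x) := by
  -- `w` inverts `d'` modulo `2^(r+3)`: the `3` gives `d * w ≡ 1` modulo `8`, so `d * w` is a 2-adic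
  -- square, and the `r` transports this back to `d`.
  obtain ⟨w, s, hw⟩ := ((isCoprime_two_iff d').mpr hd).pow_right (n := r + 3)
  have h1 : d * w ≡ 1 [ZMOD 8] := by
    refine (h.mul_right w).trans (Int.modEq_iff_dvd.mpr ⟨s * 2 ^ r, ?_⟩)
    rw [pow_add] at hw
    linear_combination -hw
  obtain ⟨c, hc, hcd⟩ := exists_sq_modEq_two_pow h1 r
  refine gaussSum_smul_eq ψ hT hψ (c := c) hc ?_
  have h2 : d * w * d' ≡ d [ZMOD ((2 : ℕ) : ℤ) ^ r] := by
    refine Int.modEq_iff_dvd.mpr ⟨d * s * 2 ^ 3, ?_⟩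
    rw [pow_add] at hw
    push_cast
    linear_combination (-d) * hw
  exact h2.symm.trans ((hcd.mul_right d').symm)

/-- Equality of products of Gauss sums from a congruence of diagonal matrices. -/
theorem prod_gaussSum_eq {p r : ℕ} (hT : ∀ x : T, (p : ℤ) ^ r • x = 0)
    (hψ : ∀ x : T, (p : ℤ) ^ r • ψ x = 0) {m : ℕ} (d d' : Fin m → ℤ)
    (h : Similar p r (Matrix.diagonal d) (Matrix.diagonal d')) :
    ∏ i, gaussSum (fun x => d i • ψ x) = ∏ i, gaussSum (fun x => d' i • ψ x) := by
  rw [← matSum_diagonal, ← matSum_diagonal]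
  exact matSum_eq_of_similar ψ hT hψ (Matrix.isSymm_diagonal _) (Matrix.isSymm_diagonal _) h

theorem gaussSum_neg_smul (d : ℤ) :
    gaussSum (fun x => (-d) • ψ x) = starRingEnd ℂ (gaussSum (fun x => d • ψ x)) := by
  rw [← gaussSum_neg]
  simp only [neg_smul]

theorem gaussSum_one_smul : gaussSum (fun x => (1 : ℤ) • ψ x) = gaussSum ψ := by
  simp only [one_smul]

variable {r : ℕ} (hT : ∀ x : T, ((2 : ℕ) : ℤ) ^ r • x = 0)
  (hψ : ∀ x : T, ((2 : ℕ) : ℤ) ^ r • ψ x = 0)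

include hT hψ

/-- The form `⟨1⟩^4` is similar to `⟨7⟩^4`, and `7 ≡ -1` modulo `8`, so `G^4` equals its conjugate.
-/
theorem direction_pow_eight (h0 : gaussSum ψ ≠ 0) : direction (gaussSum ψ) ^ 8 = 1 := by
  have h := prod_gaussSum_eq ψ hT hψ (fun _ : Fin 4 => 1) (fun _ : Fin 4 => 7)
    -- Left multiplication by the quaternion `2 + i + j + k`, of norm `7`.
    (similar_of_eq !![2, -1, -1, -1; 1, 2, -1, 1; 1, 1, 2, -1; 1, -1, 1, 2]
      (by
        rw [Nat.cast_ofNat, isCoprime_two_iff]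
        simp [Matrix.det_succ_row_zero, Fin.sum_univ_succ, Fin.succAbove])
      (by
        ext i j
        fin_cases i <;> fin_cases j <;> simp [Matrix.mul_apply, Fin.sum_univ_succ]))
  simp only [Finset.prod_const, Finset.card_univ, Fintype.card_fin] at h
  rw [gaussSum_smul_eq_of_modEq_eight ψ hT hψ (d := 7) (d' := -1) (by decide) (by decide),
    gaussSum_neg_smul, gaussSum_one_smul] at h
  have h1 := congrArg direction h
  rw [direction_pow, direction_pow, direction_conj h0, inv_pow] at h1
  have h2 : direction (gaussSum ψ) ^ 4 ≠ 0 := pow_ne_zero _ (direction_ne_zero h0)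
  rw [show 8 = 4 + 4 from rfl, pow_add]
  nth_rewrite 1 [h1]
  exact inv_mul_cancel₀ h2

theorem gaussSum_three_smul_sq :
    gaussSum (fun x => (3 : ℤ) • ψ x) ^ 2 = starRingEnd ℂ (gaussSum ψ) ^ 2 := by
  have h := prod_gaussSum_eq ψ hT hψ (fun _ : Fin 2 => 3) (fun _ : Fin 2 => 15)
    -- Multiplication by `1 + 2i`, of norm `5`; then `3 * 5 = 15 ≡ -1` modulo `8`.
    (similar_of_eq !![1, -2; 2, 1]
      (by
        rw [Nat.cast_ofNat, isCoprime_two_iff]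
        simp [Matrix.det_fin_two_of])
      (by
        ext i j
        fin_cases i <;> fin_cases j <;> simp [Matrix.mul_apply, Fin.sum_univ_succ]))
  simp only [Finset.prod_const, Finset.card_univ, Fintype.card_fin] at h
  rwa [gaussSum_smul_eq_of_modEq_eight ψ hT hψ (d := 15) (d' := -1) (by decide) (by decide),
    gaussSum_neg_smul, gaussSum_one_smul] at h

/-- `⟨1⟩ ⊥ H_{a,b}` is diagonalizable over the odd integers. -/
theorem gaussSum_mul_matSum_pseudoHyperbolic (a b : ℤ) :
    gaussSum ψ * matSum ψ (pseudoHyperbolic a b) =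
      gaussSum (fun x => (2 * a + 1) • ψ x) * gaussSum (fun x => (2 * b + 1) • ψ x) *
        gaussSum (fun x => ((2 * a + 1) * (2 * b + 1) * (4 * a * b - 1)) • ψ x) := by
  let A : Matrix (Fin 3) (Fin 3) ℤ := !![2 * a, 1, 0; 1, 2 * b, 0; 0, 0, 1]
  let d : Fin 3 → ℤ := ![2 * a + 1, 2 * b + 1, (2 * a + 1) * (2 * b + 1) * (4 * a * b - 1)]
  have hA : A.IsSymm := by
    ext i j
    fin_cases i <;> fin_cases j <;> rfl
  have h1 : matSum ψ A = gaussSum ψ * matSum ψ (pseudoHyperbolic a b) := by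
    let f : Fin 2 ⊕ Fin 1 ≃ Fin 3 := finSumFinEquiv
    rw [← matSum_submatrix ψ hA f]
    have : A.submatrix f f = Matrix.fromBlocks (pseudoHyperbolic a b) 0 0 1 := by
      ext (i | i) (j | j) <;> fin_cases i <;> fin_cases j <;> rfl
    rw [this, matSum_fromBlocks ψ (pseudoHyperbolic_isSymm a b) Matrix.isSymm_one,
      matSum_of_unique (ι := Fin 1), Matrix.one_apply_eq, gaussSum_one_smul, mul_comm]
  have h2 : matSum ψ A = matSum ψ (Matrix.diagonal d) := by
    refine matSum_eq_of_similar ψ hT hψ hA (Matrix.isSymm_diagonal d) (similar_of_eq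
      -- The columns `e₁ + e₃` and `e₂ - e₃` are orthogonal with odd values; the third column spans
      -- their orthogonal complement.
      !![1, 0, 2 * b + 1; 0, 1, -(1 + 2 * a); 1, -1, -2 * a * (2 * b + 1) + (1 + 2 * a)] ?_ ?_)
    · rw [Nat.cast_ofNat, isCoprime_two_iff, Matrix.det_fin_three]
      simp
      ring_nf
      omega
    · ext i j
      fin_cases i <;> fin_cases j <;> simp [A, d, Matrix.mul_apply, Fin.sum_univ_succ] <;> ring
  rw [← h1, h2, matSum_diagonal, Fin.prod_univ_three]
  rfl

end TwoAdic

/-! ### The phase formula for reduced forms, `p = 2`. -/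

section TwoAdicFormula

/-- `χ(d) = 1` if `d ≡ ±1` modulo `8`, and `-1` otherwise. -/
def signEight (d : ℤ) : ℤ := ZMod.χ₈ (d : ZMod 8)

theorem signEight_sq {d : ℤ} (hd : d % 2 = 1) : (signEight d : ℂ) ^ 2 = 1 := by
  have h : ∀ c : ZMod 8, ZMod.χ₈ (2 * c + 1) ^ 2 = 1 := by decide
  have h1 : signEight d ^ 2 = 1 := by
    have := h ((d / 2 : ℤ) : ZMod 8)
    have h3 : d = 2 * (d / 2) + 1 := by omega
    rw [h3, signEight, Int.cast_add, Int.cast_mul]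
    exact this
  exact_mod_cast h1

theorem zpow_eq_zpow_of_modEq {w : ℂ} (h8 : w ^ 8 = 1) {a b : ℤ} (h : a ≡ b [ZMOD 8]) :
    w ^ a = w ^ b := by
  have hw : w ≠ 0 := by
    rintro rfl
    norm_num at h8
  obtain ⟨k, hk⟩ := h.dvd
  have hb : b = a + 8 * k := by linarith
  rw [hb, zpow_add₀ hw, zpow_mul]
  have : w ^ (8 : ℤ) = 1 := by exact_mod_cast h8
  rw [this, one_zpow, mul_one]

variable {T : Type*} [AddCommGroup T] [Finite T] (ψ : QuadraticMap ℤ T UnitAddCircle)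
variable {r : ℕ} (hT : ∀ x : T, ((2 : ℕ) : ℤ) ^ r • x = 0)
  (hψ : ∀ x : T, ((2 : ℕ) : ℤ) ^ r • ψ x = 0)

include hT in
/-- The hexagonal form has an automorphism of order three without fixed vectors. -/
theorem isIntegral_matSum_hexagonal_sub_one_div_three :
    IsIntegral ℤ ((matSum ψ (pseudoHyperbolic 1 1) - 1) / 3) := by
  -- The rotation of order three of the hexagonal lattice, with `1 + M + M^2 = 0`.
  let M : Matrix (Fin 2) (Fin 2) ℤ := !![-1, -1; 1, 0]
  let L := (Matrix.toLin' M).rTensor T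
  have hs := isSymm_toBilin' (pseudoHyperbolic_isSymm 1 1)
  have hM : M.transpose * pseudoHyperbolic 1 1 * M = pseudoHyperbolic 1 1 := by decide
  have hkill : ∀ z : (Fin 2 → ℤ) ⊗[ℤ] T, ((2 : ℕ) : ℤ) ^ r • z = 0 := by
    intro z
    induction z using TensorProduct.induction_on with
    | zero => rw [smul_zero]
    | tmul v x => rw [← TensorProduct.tmul_smul, hT, TensorProduct.tmul_zero]
    | add a b ha hb => rw [smul_add, ha, hb, add_zero]
  have hLL : ∀ z, L (L z) = ((Matrix.toLin' (M * M)).rTensor T) z := by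
    intro z
    rw [Matrix.toLin'_mul, LinearMap.rTensor_comp]
    rfl
  have hsum : ∀ z, z + L z + L (L z) = 0 := by
    intro z
    have h1 : (1 + M + M * M : Matrix (Fin 2) (Fin 2) ℤ) = 0 := by decide
    rw [hLL]
    have h2 : (Matrix.toLin' (1 + M + M * M)).rTensor T z = 0 := by rw [h1]; simp
    rw [map_add, map_add, LinearMap.rTensor_add, LinearMap.rTensor_add, Matrix.toLin'_one,
      LinearMap.rTensor_id] at h2
    exact h2
  have hL3 : ∀ z, L (L (L z)) = z := by
    intro z
    have h1 := hsum z
    have h2 := hsum (L z)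
    rw [← h1, add_comm _ (L (L (L z))), add_assoc z, add_comm z] at h2
    have h3 : L (L (L z)) + (L z + L (L z)) = L z + L (L z) + z := h2
    rw [add_comm (L (L (L z)))] at h3
    exact add_left_cancel h3
  refine isIntegral_gaussSum_sub_one_div_three _ (N := 2 ^ r * 2 ^ r) (by positivity) ?_ L hL3 ?_
    0 (QuadraticMap.map_zero _) ?_
  · intro z
    have := QuadraticMap.map_smul (tensorQuadratic (Matrix.toBilin' (pseudoHyperbolic 1 1)) ψ)
      (((2 : ℕ) : ℤ) ^ r) z
    have hz : (((2 : ℕ) : ℤ) ^ r) • z = 0 := hkill z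
    rw [← natCast_zsmul]
    push_cast at this hz ⊢
    rw [← this]
    convert QuadraticMap.map_zero (tensorQuadratic (Matrix.toBilin' (pseudoHyperbolic 1 1)) ψ)
  · intro z
    refine tensorQuadratic_comp_rTensor _ hs _ hs (Matrix.toLin' M) ψ ?_ z
    intro x w y
    congr 1
    conv_rhs => rw [← hM]
    simp only [Matrix.toBilin'_apply', Matrix.toLin'_apply, ← Matrix.mulVec_mulVec,
        Matrix.dotProduct_mulVec, Matrix.vecMul_transpose]
  · intro z
    refine ⟨fun h => ?_, fun h => by rw [h, map_zero]⟩
    have h1 := hsum z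
    rw [h, h] at h1
    -- For a fixed vector, `z + Lz + L²z = 0` reads `3z = 0`, and `3` is invertible on a 2-group.
    have h3 : (3 : ℤ) • z = 0 := by
      rw [← h1]
      exact (by norm_num : (3 : ℤ) = 1 + 1 + 1) ▸ by simp only [add_smul, one_smul]
    have hcop : IsCoprime (3 : ℤ) (((2 : ℕ) : ℤ) ^ r) :=
      IsCoprime.pow_right ⟨1, -1, by norm_num⟩
    obtain ⟨a, b, hab⟩ := hcop
    rw [← one_smul ℤ z, ← hab, add_smul, mul_smul, mul_smul, h3, hkill z, smul_zero, smul_zero,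
      add_zero]

variable (hψt : IsTame ψ) {e : ℕ} (he : Nat.card T = 2 ^ e * Nat.card (perp ψ))

include hT hψ

theorem gaussSum_mul_matSum_hexagonal :
    gaussSum ψ * matSum ψ (pseudoHyperbolic 1 1) = gaussSum (fun x => (3 : ℤ) • ψ x) ^ 3 := by
  have h := gaussSum_mul_matSum_pseudoHyperbolic ψ hT hψ 1 1
  norm_num at h
  rw [h, gaussSum_smul_eq_of_modEq_eight ψ hT hψ (d := 27) (d' := 3) (by decide) (by decide)]
  ring

include hψt

theorem direction_gaussSum_three_smul_sq :
    direction (gaussSum (fun x => (3 : ℤ) • ψ x)) ^ 2 = (direction (gaussSum ψ) ^ 2)⁻¹ := by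
  rw [← direction_pow, gaussSum_three_smul_sq ψ hT hψ, direction_pow,
    direction_conj (gaussSum_ne_zero ψ hψt), inv_pow]

theorem direction_gaussSum_three_smul :
    direction (gaussSum (fun x => (3 : ℤ) • ψ x)) =
      direction (matSum ψ (pseudoHyperbolic 1 1)) * direction (gaussSum ψ) ^ 3 := by
  have h0 := direction_ne_zero (gaussSum_ne_zero ψ hψt)
  have h1 := congrArg direction (gaussSum_mul_matSum_hexagonal ψ hT hψ)
  rw [direction_mul, direction_pow, pow_succ,
    direction_gaussSum_three_smul_sq ψ hT hψ hψt] at h1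
  field_simp at h1
  linear_combination -h1

include he

/-- The relations for `⟨3⟩` make this sum `δ |T||T^⊥|` with `δ = ±1`. It is `1` modulo `3`, whereas
`|T||T^⊥| = 2^e |T^⊥|^2` is `(-1)^e` modulo `3`; this fixes `δ`. -/
theorem direction_matSum_hexagonal :
    direction (matSum ψ (pseudoHyperbolic 1 1)) = (-1) ^ e := by
  have hG := gaussSum_ne_zero ψ hψt
  have h0 := direction_ne_zero hG
  set H := matSum ψ (pseudoHyperbolic 1 1)
  -- Comparing the two expressions for the squared direction of `G(3ψ)` leaves a factor `g^8 = 1`.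
  have hsq : direction H ^ 2 = 1 := by
    have h1 := direction_gaussSum_three_smul_sq ψ hT hψ hψt
    rw [direction_gaussSum_three_smul ψ hT hψ hψt] at h1
    field_simp at h1
    have h8 := direction_pow_eight ψ hT hψ hG
    linear_combination h1 - direction H ^ 2 * h8
  have hnorm : ‖H‖ = Nat.card T * Nat.card (perp ψ) := by
    rw [← norm_gaussSum_sq ψ hψt]
    have h1 := congrArg norm (gaussSum_mul_matSum_hexagonal ψ hT hψ)
    have h2 := congrArg norm (gaussSum_three_smul_sq ψ hT hψ)
    rw [norm_pow, norm_pow, Complex.norm_conj] at h2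
    have h3 := (sq_eq_sq₀ (norm_nonneg _) (norm_nonneg _)).mp h2
    rw [norm_mul, norm_pow, h3] at h1
    have hn : ‖gaussSum ψ‖ ≠ 0 := norm_ne_zero_iff.mpr hG
    apply mul_left_cancel₀ hn
    rw [h1]; ring
  have hint : IsIntegral ℤ ((H - 1) / 3) := isIntegral_matSum_hexagonal_sub_one_div_three ψ hT
  have hp3 : ((Nat.card (perp ψ) : ℤ) ^ 2) ≡ 1 [ZMOD 3] := by
    have h2 : Nat.card (perp ψ) % 3 ≠ 0 := by
      intro h
      obtain ⟨x, hx⟩ := exists_prime_addOrderOf_dvd_card' (G := perp ψ) 3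
        (hp := ⟨Nat.prime_three⟩) (Nat.dvd_of_mod_eq_zero h)
      have h3 : addOrderOf x ∣ 2 ^ r := by
        rw [addOrderOf_dvd_iff_nsmul_eq_zero]
        ext
        have := hT x
        rw [← natCast_zsmul]
        simpa using this
      rw [hx] at h3
      have := Nat.Prime.dvd_of_dvd_pow Nat.prime_three h3
      omega
    have h4 : (Nat.card (perp ψ) : ℤ) % 3 = 1 ∨ (Nat.card (perp ψ) : ℤ) % 3 = 2 := by omega
    rcases h4 with h | h <;> simp [Int.ModEq, pow_two, Int.mul_emod, h]
  have hcard : (Nat.card T * Nat.card (perp ψ) : ℤ) ≡ (-1) ^ e [ZMOD 3] := by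
    rw [he]
    push_cast
    rw [mul_assoc, ← pow_two]
    have : (2 : ℤ) ≡ -1 [ZMOD 3] := by decide
    simpa using (this.pow e).mul hp3
  have hmain : ∀ δ : ℤ, direction H = δ → (3 : ℤ) ∣ δ * (Nat.card T * Nat.card (perp ψ)) - 1 := by
    intro δ hδ
    apply dvd_of_isIntegral_div (by norm_num)
    have : H = ((Nat.card T * Nat.card (perp ψ) : ℝ) : ℂ) * δ := by
      rw [← hδ, ← hnorm, norm_mul_direction]
    rw [this] at hint
    convert hint using 2
    · push_cast
      ring
    · norm_num
  have hmod : ∀ δ : ℤ, direction H = δ → δ * (-1) ^ e ≡ 1 [ZMOD 3] := fun δ hδ =>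
    (hcard.symm.mul_left δ).trans (Int.modEq_iff_dvd.mpr (hmain δ hδ)).symm
  have hsq' : (direction H - 1) * (direction H + 1) = 0 := by linear_combination hsq
  rcases mul_eq_zero.mp hsq' with h | h
  · have h1 : direction H = ((1 : ℤ) : ℂ) := by push_cast; linear_combination h
    have h2 := hmod 1 h1
    rcases neg_one_pow_eq_or ℤ e with h' | h'
    · rw [h1]; exact_mod_cast h'.symm
    · rw [h'] at h2; exact absurd h2 (by decide)
  · have h1 : direction H = ((-1 : ℤ) : ℂ) := by push_cast; linear_combination h
    have h2 := hmod (-1) h1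
    rcases neg_one_pow_eq_or ℤ e with h' | h'
    · rw [h'] at h2; exact absurd h2 (by decide)
    · rw [h1]; exact_mod_cast h'.symm

/-- Both sides depend only on `d` modulo `8`, and replacing `d` by `-d` conjugates them, so the
cases `1` and `3` suffice. -/
theorem direction_gaussSum_smul_two {d : ℤ} (hd : d % 2 = 1) :
    gaussSum (fun x => d • ψ x) ≠ 0 ∧ direction (gaussSum (fun x => d • ψ x)) =
      direction (gaussSum ψ) ^ d * (signEight d : ℂ) ^ e := by
  have hG := gaussSum_ne_zero ψ hψt
  have h8 := direction_pow_eight ψ hT hψ hG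
  have h3 : gaussSum (fun x => (3 : ℤ) • ψ x) ≠ 0 := by
    intro h
    have := gaussSum_three_smul_sq ψ hT hψ
    rw [h, zero_pow two_ne_zero] at this
    have h1 := pow_eq_zero_iff two_ne_zero |>.mp this.symm
    exact hG (by simpa using h1)
  have hu3 := direction_gaussSum_three_smul ψ hT hψ hψt
  rw [direction_matSum_hexagonal ψ hT hψ hψt he] at hu3
  let P : ℤ → Prop := fun c => gaussSum (fun x => c • ψ x) ≠ 0 ∧
    direction (gaussSum (fun x => c • ψ x)) =
      direction (gaussSum ψ) ^ c * (signEight c : ℂ) ^ e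
  have key : ∀ c : ℤ, c % 2 = 1 → d ≡ c [ZMOD 8] → P c → P d := fun c hc hdc h => by
    have hs : signEight d = signEight c := by
      rw [signEight, signEight]
      congr 1
      exact (ZMod.intCast_eq_intCast_iff d c 8).mpr hdc
    simp only [P]
    rwa [gaussSum_smul_eq_of_modEq_eight ψ hT hψ hc hdc, zpow_eq_zpow_of_modEq h8 hdc, hs]
  have hconj : ∀ c : ℤ, signEight (-c) = signEight c → (signEight c = 1 ∨ signEight c = -1) →
      P c → P (-c) := by
    intro c h1 h2 h
    refine ⟨?_, ?_⟩
    · rw [gaussSum_neg_smul]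
      simpa using h.1
    · rw [gaussSum_neg_smul, direction_conj h.1, h.2, mul_inv, zpow_neg, h1]
      congr 1
      rcases h2 with h2 | h2 <;> rw [h2] <;> simp
      rcases neg_one_pow_eq_or ℂ e with h' | h' <;> rw [h'] <;> norm_num
  have hP1 : P 1 := by
    refine ⟨by rwa [gaussSum_one_smul], ?_⟩
    rw [gaussSum_one_smul, zpow_one, show signEight 1 = 1 by decide]
    simp
  have hP3 : P 3 := by
    refine ⟨h3, ?_⟩
    rw [hu3, show signEight 3 = -1 by decide, mul_comm]
    push_cast
    rfl
  have hcases : d % 8 = 1 ∨ d % 8 = 3 ∨ d % 8 = 5 ∨ d % 8 = 7 := by omega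
  rcases hcases with h | h | h | h
  · exact key 1 (by decide) h hP1
  · exact key 3 (by decide) h hP3
  · exact key (-3) (by decide) (by unfold Int.ModEq; omega) (hconj 3 (by decide) (by decide) hP3)
  · exact key (-1) (by decide) (by unfold Int.ModEq; omega) (hconj 1 (by decide) (by decide) hP1)

/-- Cancel `⟨1⟩` from the diagonalization of `⟨1⟩ ⊥ H_{a,b}`: the three diagonal entries sum to `1`
modulo `8`, and in the product of their signs those of `2a + 1` and `2b + 1` occur twice. -/
theorem direction_matSum_pseudoHyperbolic_two (a b : ℤ) :
    matSum ψ (pseudoHyperbolic a b) ≠ 0 ∧ direction (matSum ψ (pseudoHyperbolic a b)) =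
      (signEight (4 * a * b - 1) : ℂ) ^ e := by
  have hG := gaussSum_ne_zero ψ hψt
  have h0 := direction_ne_zero hG
  have h8 := direction_pow_eight ψ hT hψ hG
  have h := gaussSum_mul_matSum_pseudoHyperbolic ψ hT hψ a b
  have h1 := direction_gaussSum_smul_two ψ hT hψ hψt he (d := 2 * a + 1) (by omega)
  have h2 := direction_gaussSum_smul_two ψ hT hψ hψt he (d := 2 * b + 1) (by omega)
  have h3 := direction_gaussSum_smul_two ψ hT hψ hψt he
    (d := (2 * a + 1) * (2 * b + 1) * (4 * a * b - 1)) (by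
      have : (2 * a + 1) * (2 * b + 1) * (4 * a * b - 1) =
        2 * ((2 * a * b + a + b) * (4 * a * b - 1) + 2 * a * b - 1) + 1 := by ring
      omega)
  refine ⟨fun h4 => ?_, ?_⟩
  · rw [h4, mul_zero] at h
    exact mul_ne_zero (mul_ne_zero h1.1 h2.1) h3.1 h.symm
  · have h5 := congrArg direction h
    rw [direction_mul, direction_mul, direction_mul, h1.2, h2.2, h3.2] at h5
    have hmul : signEight ((2 * a + 1) * (2 * b + 1) * (4 * a * b - 1)) =
        signEight (2 * a + 1) * signEight (2 * b + 1) * signEight (4 * a * b - 1) := by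
      simp only [signEight, Int.cast_mul, map_mul]
    have hexp : (2 * a + 1) + (2 * b + 1) + (2 * a + 1) * (2 * b + 1) * (4 * a * b - 1) ≡ 1
        [ZMOD 8] := by
      refine Int.modEq_iff_dvd.mpr ⟨-(2 * a ^ 2 * b ^ 2 + a ^ 2 * b + a * b ^ 2), ?_⟩
      ring
    have hz := zpow_eq_zpow_of_modEq h8 hexp
    rw [zpow_add₀ h0, zpow_add₀ h0, zpow_one] at hz
    apply mul_left_cancel₀ h0
    rw [h5, hmul]
    have ha : (signEight (2 * a + 1) : ℂ) ^ e * (signEight (2 * a + 1) : ℂ) ^ e = 1 := by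
      rw [← mul_pow, ← pow_two, signEight_sq (by omega), one_pow]
    have hb : (signEight (2 * b + 1) : ℂ) ^ e * (signEight (2 * b + 1) : ℂ) ^ e = 1 := by
      rw [← mul_pow, ← pow_two, signEight_sq (by omega), one_pow]
    push_cast
    rw [mul_pow, mul_pow]
    generalize direction (gaussSum ψ) ^ (2 * a + 1) = x at *
    generalize direction (gaussSum ψ) ^ (2 * b + 1) = y at *
    generalize direction (gaussSum ψ) ^ ((2 * a + 1) * (2 * b + 1) * (4 * a * b - 1)) = z at *
    generalize (signEight (2 * a + 1) : ℂ) ^ e = s at *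
    generalize (signEight (2 * b + 1) : ℂ) ^ e = t at *
    generalize (signEight (4 * a * b - 1) : ℂ) ^ e = v at *
    linear_combination (s * s * t * t * v) * hz + (direction (gaussSum ψ) * t * t * v) * ha +
      direction (gaussSum ψ) * v * hb

/-- The phase formula for an orthogonal sum of rank one forms and pseudo-hyperbolics, `p = 2`. -/
theorem direction_matSum_blockForm_two {m n : ℕ} (d : Fin m → ℤ) (a b : Fin n → ℤ)
    (hd : ∀ i, d i % 2 = 1) :
    matSum ψ (blockForm d a b) ≠ 0 ∧ direction (matSum ψ (blockForm d a b)) =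
      direction (gaussSum ψ) ^ (∑ i, d i) * (signEight (blockForm d a b).det : ℂ) ^ e := by
  have h0 := direction_ne_zero (gaussSum_ne_zero ψ hψt)
  have h1 := fun i => direction_gaussSum_smul_two ψ hT hψ hψt he (hd i)
  have h2 := fun k => direction_matSum_pseudoHyperbolic_two ψ hT hψ hψt he (a k) (b k)
  rw [matSum_blockForm, direction_mul, direction_prod, direction_prod]
  refine ⟨mul_ne_zero (Finset.prod_ne_zero_iff.mpr fun i _ => (h1 i).1)
    (Finset.prod_ne_zero_iff.mpr fun k _ => (h2 k).1), ?_⟩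
  rw [Finset.prod_congr rfl fun i _ => (h1 i).2, Finset.prod_congr rfl fun i _ => (h2 i).2,
    Finset.prod_mul_distrib, Finset.prod_pow, Finset.prod_pow, det_blockForm, mul_assoc,
    ← mul_pow]
  congr 1
  · have : ∀ s : Finset (Fin m), ∏ i ∈ s, direction (gaussSum ψ) ^ d i =
        direction (gaussSum ψ) ^ ∑ i ∈ s, d i := by
      intro s
      induction s using Finset.induction_on with
      | empty => simp
      | insert a s ha ih => rw [Finset.prod_insert ha, Finset.sum_insert ha, zpow_add₀ h0, ih]
    exact this _
  · congr 1
    simp only [signEight, Int.cast_mul, map_mul, Int.cast_prod, map_prod]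

end TwoAdicFormula

/-! ### The model functions `x^2 / N`. -/

section Standard

/-- The quadratic function `x ↦ x² / N` on `ℤ / N`. -/
def standardQuadratic (N : ℕ) [NeZero N] : QuadraticMap ℤ (ZMod N) UnitAddCircle :=
  LinearMap.BilinMap.toQuadraticMap
    ((LinearMap.mul ℤ (ZMod N)).compr₂ (ZMod.toAddCircle (N := N)).toIntLinearMap)

theorem standardQuadratic_apply (N : ℕ) [NeZero N] (x : ZMod N) :
    standardQuadratic N x = ZMod.toAddCircle (x * x) := rfl

theorem mem_perp_standardQuadratic (N : ℕ) [NeZero N] (x : ZMod N) :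
    x ∈ perp (standardQuadratic N) ↔ 2 * x = 0 := by
  have h : ∀ s, QuadraticMap.polar (standardQuadratic N) x s =
      ZMod.toAddCircle (2 * x * s) := by
    intro s
    rw [QuadraticMap.polar, standardQuadratic_apply, standardQuadratic_apply,
      standardQuadratic_apply, ← map_sub, ← map_sub]
    congr 1
    ring
  change (∀ s, QuadraticMap.polar (standardQuadratic N) x s = 0) ↔ _
  simp only [h]
  refine ⟨fun hs => ?_, fun hx s => by rw [hx, zero_mul, map_zero]⟩
  have h1 := hs 1
  rw [mul_one] at h1
  exact (map_eq_zero_iff _ (ZMod.toAddCircle_injective N)).mp h1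

theorem smul_standardQuadratic (N : ℕ) [NeZero N] (x : ZMod N) :
    (N : ℤ) • standardQuadratic N x = 0 := by
  rw [standardQuadratic_apply, ← map_zsmul]
  simp

theorem smul_zmod_eq_zero (N : ℕ) (x : ZMod N) : (N : ℤ) • x = 0 := by simp

end Standard

/-! ### Squares and sums of two squares modulo odd prime powers. -/

section Squares

theorem exists_sq_modEq_pow {p : ℕ} (hp : p.Prime) (hodd : p ≠ 2) {n : ℤ}
    (hn : IsCoprime n (p : ℤ)) (hsq : IsSquare (n : ZMod p)) (r : ℕ) :
    ∃ c : ℤ, IsCoprime c (p : ℤ) ∧ c ^ 2 ≡ n [ZMOD (p : ℤ) ^ r] := by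
  -- Hensel lifting has to start modulo `p`, not modulo `p^0 = 1`.
  suffices h : ∃ c : ℤ, IsCoprime c (p : ℤ) ∧ c ^ 2 ≡ n [ZMOD (p : ℤ) ^ (r + 1)] by
    obtain ⟨c, hc, h⟩ := h
    exact ⟨c, hc, h.of_dvd (pow_dvd_pow _ (Nat.le_succ r))⟩
  induction r with
  | zero =>
    obtain ⟨c, hc⟩ := hsq
    obtain ⟨c, rfl⟩ := ZMod.intCast_surjective c
    have h : c ^ 2 ≡ n [ZMOD p] := by
      rw [← ZMod.intCast_eq_intCast_iff, hc]
      push_cast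
      ring
    refine ⟨c, ?_, by simpa using h⟩
    obtain ⟨k, hk⟩ := h.dvd
    obtain ⟨x, y, hxy⟩ := hn
    exact ⟨x * c, x * k + y, by linear_combination hxy - x * hk⟩
  | succ r ih =>
    obtain ⟨c, hc, h⟩ := ih
    obtain ⟨k, hk⟩ := h.dvd
    have h2 : IsCoprime (2 : ℤ) (p : ℤ) := by
      have := (Nat.coprime_primes Nat.prime_two hp).mpr hodd.symm
      exact_mod_cast Nat.isCoprime_iff_coprime.mpr this
    -- `w` inverts `2c` modulo `p`, which gives the Newton correction.
    obtain ⟨w, s, hw⟩ := h2.mul_left hc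
    refine ⟨c + p ^ (r + 1) * (k * w), ?_, Int.modEq_iff_dvd.mpr ⟨k * s - p ^ r * (k * w) ^ 2, ?_⟩⟩
    · rw [pow_succ, mul_comm ((p : ℤ) ^ r), mul_assoc]
      exact IsCoprime.add_mul_left_left hc _
    · rw [pow_succ _ (r + 1)]
      linear_combination hk - (p : ℤ) ^ (r + 1) * k * hw

variable {T : Type*} [AddCommGroup T] [Finite T] (ψ : QuadraticMap ℤ T UnitAddCircle)
variable {p r : ℕ}

theorem gaussSum_smul_eq_of_isSquare (hp : p.Prime) (hodd : p ≠ 2)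
    (hT : ∀ x : T, (p : ℤ) ^ r • x = 0) (hψ : ∀ x : T, (p : ℤ) ^ r • ψ x = 0) {a b : ℤ}
    (ha : IsCoprime a (p : ℤ)) (hb : IsCoprime b (p : ℤ)) (h : IsSquare ((a * b : ℤ) : ZMod p)) :
    gaussSum (fun x => a • ψ x) = gaussSum (fun x => b • ψ x) := by
  obtain ⟨w, s, hw⟩ := hb.pow_right (n := r + 1)
  have hw' : ((w * b : ℤ) : ZMod p) = 1 := by
    have := congrArg (Int.cast : ℤ → ZMod p) hw
    push_cast at this ⊢
    simpa using this
  have hwc : IsCoprime w (p : ℤ) := ⟨b, s * p ^ r, by rw [← hw]; ring⟩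
  have hsq : IsSquare ((a * w : ℤ) : ZMod p) := by
    obtain ⟨t, ht⟩ := h
    refine ⟨t * w, ?_⟩
    push_cast at ht hw' ⊢
    linear_combination (w : ZMod p) ^ 2 * ht - (a * w : ZMod p) * hw'
  obtain ⟨c, hc, hcm⟩ := exists_sq_modEq_pow hp hodd (ha.mul_left hwc) hsq r
  refine gaussSum_smul_eq ψ hT hψ hc ?_
  refine Int.ModEq.trans ?_ (hcm.mul_right b).symm
  refine (Int.modEq_iff_dvd.mpr ⟨-(a * s * p), ?_⟩)
  rw [pow_succ] at hw
  linear_combination a * hw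

/-- Modulo a power of `p` the unit `a` is a sum of two squares `c^2 + y^2`, and multiplication by `c
+ yi` takes `⟨1, 1⟩` to `⟨a, a⟩`. -/
theorem gaussSum_smul_sq (hp : p.Prime) (hodd : p ≠ 2)
    (hT : ∀ x : T, (p : ℤ) ^ r • x = 0) (hψ : ∀ x : T, (p : ℤ) ^ r • ψ x = 0) {a : ℤ}
    (ha : IsCoprime a (p : ℤ)) :
    gaussSum (fun x => a • ψ x) ^ 2 = gaussSum ψ ^ 2 := by
  have : Fact p.Prime := ⟨hp⟩
  have hpi := Nat.prime_iff_prime_int.mp hp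
  obtain ⟨c, y, hcy⟩ : ∃ c y : ℤ, c ^ 2 + y ^ 2 ≡ a [ZMOD (p : ℤ) ^ (r + 1)] := by
    obtain ⟨x, y, hxy⟩ := ZMod.sq_add_sq p (a : ZMod p)
    -- One of the two squares is nonzero modulo `p`, and that one can be lifted.
    obtain ⟨x, y, hxy, hx⟩ : ∃ x y : ZMod p, x ^ 2 + y ^ 2 = a ∧ x ≠ 0 := by
      by_cases hx : x = 0
      · refine ⟨y, x, by rw [add_comm]; exact hxy, ?_⟩
        rintro rfl
        rw [hx] at hxy
        have h1 : (a : ZMod p) = 0 := by rw [← hxy]; ring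
        rw [ZMod.intCast_zmod_eq_zero_iff_dvd] at h1
        exact (not_isCoprime_iff_dvd hp a).mpr h1 ha
      · exact ⟨x, y, hxy, hx⟩
    obtain ⟨y, rfl⟩ := ZMod.intCast_surjective y
    have hn : ((a - y ^ 2 : ℤ) : ZMod p) = x ^ 2 := by
      push_cast
      rw [← hxy]; ring
    have hcop : IsCoprime (a - y ^ 2) (p : ℤ) := by
      by_contra hcon
      rw [not_isCoprime_iff_dvd hp, ← ZMod.intCast_zmod_eq_zero_iff_dvd, hn] at hcon
      exact hx (pow_eq_zero_iff two_ne_zero |>.mp hcon)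
    obtain ⟨c, -, hc⟩ := exists_sq_modEq_pow hp hodd hcop ⟨x, by rw [hn, pow_two]⟩ (r + 1)
    exact ⟨c, y, by rw [← sub_add_cancel a (y ^ 2)]; exact hc.add_right (y ^ 2)⟩
  have h := prod_gaussSum_eq ψ hT hψ (fun _ : Fin 2 => 1) (fun _ : Fin 2 => a)
    ⟨!![c, -y; y, c], by
      rw [Matrix.det_fin_two_of]
      obtain ⟨k, hk⟩ := hcy.dvd
      obtain ⟨u, v, huv⟩ := ha
      exact ⟨u, u * p ^ r * k + v, by rw [pow_succ] at hk; linear_combination huv - u * hk⟩, by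
      have hcy' := (hcy.of_dvd (pow_dvd_pow _ (Nat.le_succ r))).symm
      intro i j
      fin_cases i <;> fin_cases j <;>
        simp [Matrix.mul_apply, Fin.sum_univ_succ, Int.modEq_iff_dvd]
      · convert hcy'.dvd using 1; ring
      · ring_nf; simp
      · ring_nf; simp
      · convert hcy'.dvd using 1; ring⟩
  simp only [Finset.prod_const, Finset.card_univ, Fintype.card_fin] at h
  rwa [gaussSum_one_smul, eq_comm] at h

end Squares

/-! ### Rationality by averaging over exponents prime to `p`. -/

section Rationality

/-- For prime `p` this is a Ramanujan sum: the exponents run over the residues modulo `p^(r+1)`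
prime to `p`. It factors into a geometric sum in `z^p`, which vanishes unless `z^p = 1`, and a
geometric sum in `z` without its constant term. -/
theorem exists_sum_pow_eq_intCast {p r : ℕ} (hp : p ≠ 0) {z : ℂ} (hz : z ^ p ^ (r + 1) = 1) :
    ∃ m : ℤ, ∑ b ∈ Finset.range (p ^ r), ∑ j ∈ Finset.range (p - 1),
      z ^ (j + 1 + p * b) = m := by
  have hgeom : ∀ (w : ℂ) (n : ℕ), w ^ n = 1 → ∃ m : ℤ, ∑ b ∈ Finset.range n, w ^ b = m ∧
      (w ≠ 1 → m = 0) := by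
    intro w n hw
    by_cases h1 : w = 1
    · exact ⟨n, by simp [h1], fun h => absurd h1 h⟩
    · refine ⟨0, ?_, fun _ => rfl⟩
      have := mul_geom_sum w n
      rw [hw, sub_self] at this
      simpa [sub_eq_zero, h1] using this
  have hfac : ∑ b ∈ Finset.range (p ^ r), ∑ j ∈ Finset.range (p - 1), z ^ (j + 1 + p * b) =
      (∑ b ∈ Finset.range (p ^ r), (z ^ p) ^ b) * ∑ j ∈ Finset.range (p - 1), z ^ (j + 1) := by
    rw [Finset.sum_mul_sum]
    refine Finset.sum_congr rfl fun b _ => Finset.sum_congr rfl fun j _ => ?_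
    rw [pow_add, pow_mul, mul_comm]
  obtain ⟨m, hm, hm0⟩ := hgeom (z ^ p) (p ^ r) (by rw [← pow_mul, ← pow_succ', hz])
  rw [hfac, hm]
  by_cases h1 : z ^ p = 1
  · obtain ⟨m', hm', -⟩ := hgeom z p h1
    refine ⟨m * (m' - 1), ?_⟩
    obtain ⟨q, rfl⟩ := Nat.exists_eq_succ_of_ne_zero hp
    rw [Finset.sum_range_succ', pow_zero] at hm'
    rw [Nat.succ_sub_one]
    push_cast
    rw [← hm']
    ring
  · exact ⟨0, by rw [hm0 h1]; simp⟩

theorem isSquare_of_sq_mul_eq_sq {K N m : ℕ} (hK : K ≠ 0) (h : K ^ 2 * N = m ^ 2) :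
    IsSquare N := by
  obtain ⟨q, rfl⟩ := (Nat.pow_dvd_pow_iff two_ne_zero).mp (Dvd.intro N h)
  refine ⟨q, ?_⟩
  rw [mul_pow] at h
  rw [Nat.eq_of_mul_eq_mul_left (by positivity) h, pow_two]

theorem even_of_isSquare_pow_mul_sq {p e k : ℕ} (hp : p.Prime) (hk : k ≠ 0)
    (h : IsSquare (p ^ e * k ^ 2)) : Even e := by
  by_contra hodd
  obtain ⟨f, rfl⟩ := Nat.not_even_iff_odd.mp hodd
  obtain ⟨q, hq⟩ := h
  have : IsSquare p := isSquare_of_sq_mul_eq_sq (K := p ^ f * k) (m := q)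
    (mul_ne_zero (pow_ne_zero _ hp.ne_zero) hk) (by rw [pow_two q, ← hq]; ring)
  exact hp.prime.not_isSquare this

/-- If all `∑ exp (2 π i a f)` with `a` prime to `p` agree then their common value is rational. -/
theorem isSquare_of_gaussSum_smul_eq {S : Type*} [Finite S] (f : S → UnitAddCircle) {p r : ℕ}
    (hp : p.Prime) (hf : ∀ s, (p : ℤ) ^ r • f s = 0)
    (h : ∀ a : ℤ, IsCoprime a (p : ℤ) → gaussSum (fun s => a • f s) = gaussSum f) {N : ℕ}
    (hN : ‖gaussSum f‖ ^ 2 = N) : IsSquare N := by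
  have := Fintype.ofFinite S
  have hz : ∀ s, ∃ m : ℤ, ∑ b ∈ Finset.range (p ^ r), ∑ j ∈ Finset.range (p - 1),
      (AddCircle.toCircle (f s) : ℂ) ^ (j + 1 + p * b) = m := by
    intro s
    refine exists_sum_pow_eq_intCast hp.ne_zero ?_
    rw [← Circle.coe_pow, ← AddCircle.toCircle_nsmul, ← natCast_zsmul]
    push_cast
    rw [pow_succ', mul_smul, hf, smul_zero, AddCircle.toCircle_zero, Circle.coe_one]
  choose m hm using hz
  -- The hypothesis makes the average over exponents equal to the Gauss sum itself, while each point
  -- contributes an integer.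
  have hsum : ((p ^ r * (p - 1) : ℕ) : ℂ) * gaussSum f = ((∑ s, m s : ℤ) : ℂ) := by
    calc _ = ∑ b ∈ Finset.range (p ^ r), ∑ j ∈ Finset.range (p - 1), gaussSum f := by
          simp [mul_assoc]
      _ = ∑ b ∈ Finset.range (p ^ r), ∑ j ∈ Finset.range (p - 1),
            ∑ s, (AddCircle.toCircle (f s) : ℂ) ^ (j + 1 + p * b) := by
          refine Finset.sum_congr rfl fun b _ => Finset.sum_congr rfl fun j hj => ?_
          have hcop : IsCoprime ((j + 1 + p * b : ℕ) : ℤ) (p : ℤ) := by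
            rw [Nat.isCoprime_iff_coprime, Nat.coprime_add_mul_left_left]
            have := Finset.mem_range.mp hj
            exact Nat.coprime_comm.mp (Nat.coprime_of_lt_prime (by omega) (by omega) hp)
          rw [← h _ hcop, gaussSum_eq_sum]
          refine Finset.sum_congr rfl fun s _ => ?_
          rw [natCast_zsmul, AddCircle.toCircle_nsmul, Circle.coe_pow]
      _ = ∑ s, ∑ b ∈ Finset.range (p ^ r), ∑ j ∈ Finset.range (p - 1),
            (AddCircle.toCircle (f s) : ℂ) ^ (j + 1 + p * b) :=
          (Finset.sum_congr rfl fun b _ => Finset.sum_comm).trans Finset.sum_comm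
      _ = _ := by
          push_cast
          exact Finset.sum_congr rfl fun s _ => hm s
  have hnorm := congrArg (fun z => ‖z‖ ^ 2) hsum
  simp only [norm_mul, mul_pow, Complex.norm_natCast, hN, Complex.norm_intCast, sq_abs] at hnorm
  refine isSquare_of_sq_mul_eq_sq (K := p ^ r * (p - 1)) (m := (∑ s, m s).natAbs) ?_ ?_
  · have := hp.two_le
    exact mul_ne_zero (pow_ne_zero _ hp.ne_zero) (by omega)
  · zify
    rw [sq_abs]
    exact_mod_cast hnorm

end Rationality

/-! ### The phase formula for reduced forms, `p` odd. -/

section OddFormula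

variable {T : Type*} [AddCommGroup T] [Finite T] (ψ : QuadraticMap ℤ T UnitAddCircle)
variable {p r : ℕ} [Fact p.Prime]

theorem legendreSym_eq_neg_one_of_not_isSquare {a : ℤ} (h : ¬ IsSquare (a : ZMod p)) :
    legendreSym p a = -1 := (legendreSym.eq_neg_one_iff p).mpr h

/-- All sums `∑ exp (2 π i b ψ)` with `b` prime to `p` agree if this holds for one non-residue. -/
theorem gaussSum_smul_eq_mul_of_nonresidue (hodd : p ≠ 2)
    (hT : ∀ x : T, (p : ℤ) ^ r • x = 0) (hψ : ∀ x : T, (p : ℤ) ^ r • ψ x = 0) {a b : ℤ}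
    (ha : IsCoprime a (p : ℤ)) (hsq : ¬ IsSquare (a : ZMod p)) (hb : IsCoprime b (p : ℤ)) :
    gaussSum (fun x => b • ψ x) =
      if IsSquare (b : ZMod p) then gaussSum ψ else gaussSum (fun x => a • ψ x) := by
  have hp : p.Prime := Fact.out
  split_ifs with h
  · rw [← gaussSum_one_smul ψ]
    exact gaussSum_smul_eq_of_isSquare ψ hp hodd hT hψ hb isCoprime_one_left (by rwa [mul_one])
  · refine gaussSum_smul_eq_of_isSquare ψ hp hodd hT hψ hb ha ?_
    have hb0 : (b : ZMod p) ≠ 0 := fun h0 => h (h0 ▸ IsSquare.zero)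
    have ha0 : (a : ZMod p) ≠ 0 := fun h0 => hsq (h0 ▸ IsSquare.zero)
    have h1 : legendreSym p (b * a) = 1 := by
      rw [legendreSym.mul, legendreSym_eq_neg_one_of_not_isSquare h,
        legendreSym_eq_neg_one_of_not_isSquare hsq]
      norm_num
    refine (legendreSym.eq_one_iff p ?_).mp h1
    push_cast
    exact mul_ne_zero hb0 ha0

/-- With the other sign all `G(bψ)`, `b` prime to `p`, would agree, and `p^e |T^⊥|^2` would be a
square. -/
theorem gaussSum_smul_of_odd (hodd : p ≠ 2)
    (hT : ∀ x : T, (p : ℤ) ^ r • x = 0) (hψ : ∀ x : T, (p : ℤ) ^ r • ψ x = 0) (hψt : IsTame ψ)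
    {e : ℕ} (he : Nat.card T = p ^ e * Nat.card (perp ψ)) (heo : Odd e) {a : ℤ}
    (ha : IsCoprime a (p : ℤ)) (hsq : ¬ IsSquare (a : ZMod p)) :
    gaussSum (fun x => a • ψ x) = -gaussSum ψ := by
  have hp : p.Prime := Fact.out
  refine (sq_eq_sq_iff_eq_or_eq_neg.mp (gaussSum_smul_sq ψ hp hodd hT hψ ha)).resolve_left ?_
  intro h
  have hS := isSquare_of_gaussSum_smul_eq ψ hp hψ (N := p ^ e * Nat.card (perp ψ) ^ 2)
    (fun b hb => by
      rw [gaussSum_smul_eq_mul_of_nonresidue ψ hodd hT hψ ha hsq hb, h, ite_self])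
    (by rw [norm_gaussSum_sq ψ hψt, he]; push_cast; ring)
  exact Nat.not_even_iff_odd.mpr heo
    (even_of_isSquare_pow_mul_sq hp (Nat.card_pos (α := perp ψ)).ne' hS)

theorem perp_standardQuadratic_of_odd (hodd : p ≠ 2) :
    perp (standardQuadratic p) = ⊥ := by
  have hp : p.Prime := Fact.out
  rw [eq_bot_iff]
  intro x hx
  rw [mem_perp_standardQuadratic] at hx
  have h2 : ((2 : ℕ) : ZMod p) ≠ 0 := by
    rw [Ne, ZMod.natCast_eq_zero_iff]
    intro h
    exact hodd ((Nat.prime_dvd_prime_iff_eq hp Nat.prime_two).mp h)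
  push_cast at h2
  exact (mul_eq_zero.mp hx).resolve_left h2

theorem gaussSum_smul_odd_prime (hodd : p ≠ 2)
    (hT : ∀ x : T, (p : ℤ) ^ r • x = 0) (hψ : ∀ x : T, (p : ℤ) ^ r • ψ x = 0) (hψt : IsTame ψ)
    {e : ℕ} (he : Nat.card T = p ^ e * Nat.card (perp ψ)) {a : ℤ}
    (ha : IsCoprime a (p : ℤ)) :
    gaussSum (fun x => a • ψ x) = (legendreSym p a : ℂ) ^ e * gaussSum ψ := by
  have hp : p.Prime := Fact.out
  by_cases hsq : IsSquare (a : ZMod p)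
  · have ha0 : (a : ZMod p) ≠ 0 := by
      rw [Ne, ZMod.intCast_zmod_eq_zero_iff_dvd, ← not_isCoprime_iff_dvd hp, not_not]
      exact ha
    rw [(legendreSym.eq_one_iff p ha0).mpr hsq, Int.cast_one, one_pow, one_mul,
      ← gaussSum_one_smul ψ]
    exact gaussSum_smul_eq_of_isSquare ψ hp hodd hT hψ ha isCoprime_one_left (by rwa [mul_one])
  rw [legendreSym_eq_neg_one_of_not_isSquare hsq]
  rcases Nat.even_or_odd e with hev | heo
  · push_cast
    rw [hev.neg_one_pow, one_mul]
    refine (sq_eq_sq_iff_eq_or_eq_neg.mp (gaussSum_smul_sq ψ hp hodd hT hψ ha)).resolve_right ?_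
    intro h
    have hbot := perp_standardQuadratic_of_odd (p := p) hodd
    have hcard : Nat.card (perp (standardQuadratic p)) = 1 := by rw [hbot]; simp
    have ht₀ : IsTame (standardQuadratic p) := by
      intro t ht
      rw [hbot, AddSubgroup.mem_bot] at ht
      rw [ht, QuadraticMap.map_zero]
    have hT₀ : ∀ x : ZMod p, (p : ℤ) ^ 1 • x = 0 := fun x => by
      rw [pow_one]; exact smul_zmod_eq_zero p x
    have hψ₀ : ∀ x : ZMod p, (p : ℤ) ^ 1 • standardQuadratic p x = 0 := fun x => by
      rw [pow_one]; exact smul_standardQuadratic p x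
    have h₀ := gaussSum_smul_of_odd (standardQuadratic p) hodd hT₀ hψ₀ ht₀ (e := 1)
      (by rw [hcard]; simp) odd_one ha hsq
    -- If the sign were `-1` for even `e`, it would cancel against the sign `-1` of `x^2 / p`. The
    -- sums of `ψ ⊕ x^2 / p` would then all agree although its exponent `e + 1` is odd.
    have hS := isSquare_of_gaussSum_smul_eq
      (fun z : T × ZMod p => ψ z.1 + standardQuadratic p z.2) hp (r := r + 1)
      (N := p ^ (e + 1) * Nat.card (perp ψ) ^ 2) ?_ ?_ ?_
    · have := even_of_isSquare_pow_mul_sq hp (Nat.card_pos (α := perp ψ)).ne' hS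
      exact (Nat.even_add_one.mp this) hev
    · rintro ⟨x, y⟩
      rw [smul_add, pow_succ', mul_smul, hψ, smul_zero, zero_add, mul_comm, mul_smul,
        smul_standardQuadratic, smul_zero]
    · intro b hb
      simp only [smul_add]
      rw [gaussSum_prod (fun x => b • ψ x) (fun y => b • standardQuadratic p y),
        gaussSum_prod ψ (standardQuadratic p),
        gaussSum_smul_eq_mul_of_nonresidue ψ hodd hT hψ ha hsq hb,
        gaussSum_smul_eq_mul_of_nonresidue _ hodd hT₀ hψ₀ ha hsq hb, h, h₀]
      split_ifs <;> ring
    · rw [gaussSum_prod ψ (standardQuadratic p), norm_mul, mul_pow, norm_gaussSum_sq ψ hψt,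
        norm_gaussSum_sq _ ht₀, hcard, he]
      simp
      ring
  · push_cast
    rw [heo.neg_one_pow, neg_one_mul]
    exact gaussSum_smul_of_odd ψ hodd hT hψ hψt he heo ha hsq

/-- Taking `a = -1` in `gaussSum_smul_sq` shows that `G^2` is real, so even the fourth power is `1`;
the exponent `8` matches `σ_p` modulo `8`. -/
theorem direction_pow_eight_of_odd (hodd : p ≠ 2)
    (hT : ∀ x : T, (p : ℤ) ^ r • x = 0) (hψ : ∀ x : T, (p : ℤ) ^ r • ψ x = 0)
    (h0 : gaussSum ψ ≠ 0) : direction (gaussSum ψ) ^ 8 = 1 := by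
  have h := gaussSum_smul_sq ψ Fact.out hodd hT hψ (a := -1) isCoprime_one_left.neg_left
  rw [gaussSum_neg_smul, gaussSum_one_smul] at h
  have h1 := congrArg direction h
  rw [direction_pow, direction_pow, direction_conj h0, inv_pow] at h1
  have h2 : direction (gaussSum ψ) ^ 2 ≠ 0 := pow_ne_zero _ (direction_ne_zero h0)
  have h4 : direction (gaussSum ψ) ^ 4 = 1 := by
    rw [show 4 = 2 + 2 from rfl, pow_add]
    nth_rewrite 1 [← h1]
    exact inv_mul_cancel₀ h2
  rw [show 8 = 4 * 2 from rfl, pow_mul, h4, one_pow]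

/-- `H_{a,b}` is diagonalizable over the `p`-adic integers if `p` is odd. -/
theorem matSum_pseudoHyperbolic_of_odd (hodd : p ≠ 2)
    (hT : ∀ x : T, (p : ℤ) ^ r • x = 0) (hψ : ∀ x : T, (p : ℤ) ^ r • ψ x = 0) (hψt : IsTame ψ)
    {e : ℕ} (he : Nat.card T = p ^ e * Nat.card (perp ψ)) {a b : ℤ}
    (ha : (p : ℤ) ∣ 2 * a) (hb : (p : ℤ) ∣ 2 * b) :
    matSum ψ (pseudoHyperbolic a b) =
      (legendreSym p (4 * a * b - 1) : ℂ) ^ e * gaussSum ψ ^ 2 := by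
  have hp : p.Prime := Fact.out
  obtain ⟨a', ha'⟩ := ha
  obtain ⟨b', hb'⟩ := hb
  have h2 : IsCoprime (2 : ℤ) (p : ℤ) := by
    have := (Nat.coprime_primes Nat.prime_two hp).mpr hodd.symm
    exact_mod_cast Nat.isCoprime_iff_coprime.mpr this
  have hn : IsCoprime (2 * a + 2 * b + 2) (p : ℤ) := by
    rw [ha', hb', ← mul_add, add_comm]
    exact IsCoprime.add_mul_left_left h2 _
  have hdet : IsCoprime (4 * a * b - 1) (p : ℤ) :=
    ⟨-1, a' * (2 * b), by linear_combination (-2 * b) * ha'⟩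
  have h := matSum_eq_of_similar ψ hT hψ (pseudoHyperbolic_isSymm a b)
    (Matrix.isSymm_diagonal ![2 * a + 2 * b + 2, (2 * a + 2 * b + 2) * (4 * a * b - 1)])
    -- The vector `(1, 1)` has value `2a + 2b + 2 ≡ 2` modulo `p`, a unit; the second column spans
    -- its orthogonal complement.
    (similar_of_eq !![1, 1 + 2 * b; 1, -(1 + 2 * a)] (by
      rw [Matrix.det_fin_two_of]
      have := hn.neg_left
      rwa [show 1 * -(1 + 2 * a) - (1 + 2 * b) * 1 = -(2 * a + 2 * b + 2) by ring]) (by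
      ext i j
      fin_cases i <;> fin_cases j <;>
        simp [pseudoHyperbolic, Matrix.mul_apply, Fin.sum_univ_succ] <;> ring))
  rw [h, matSum_diagonal, Fin.prod_univ_two]
  simp only [Matrix.cons_val_zero, Matrix.cons_val_one]
  rw [gaussSum_smul_odd_prime ψ hodd hT hψ hψt he hn,
    gaussSum_smul_odd_prime ψ hodd hT hψ hψt he (hn.mul_left hdet), legendreSym.mul]
  have hn0 : ((2 * a + 2 * b + 2 : ℤ) : ZMod p) ≠ 0 := by
    rw [Ne, ZMod.intCast_zmod_eq_zero_iff_dvd, ← not_isCoprime_iff_dvd hp, not_not]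
    exact hn
  have hs : (legendreSym p (2 * a + 2 * b + 2) : ℂ) ^ 2 = 1 := by
    exact_mod_cast legendreSym.sq_one p hn0
  have hs' : (legendreSym p (2 * a + 2 * b + 2) : ℂ) ^ e *
      (legendreSym p (2 * a + 2 * b + 2) : ℂ) ^ e = 1 := by
    rw [← mul_pow, ← pow_two, hs, one_pow]
  push_cast
  rw [mul_pow]
  linear_combination ((legendreSym p (4 * a * b - 1) : ℂ) ^ e * gaussSum ψ ^ 2) * hs'

/-- The phase formula for an orthogonal sum of rank one forms and pseudo-hyperbolics, `p` odd. -/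
theorem matSum_blockForm_of_odd (hodd : p ≠ 2)
    (hT : ∀ x : T, (p : ℤ) ^ r • x = 0) (hψ : ∀ x : T, (p : ℤ) ^ r • ψ x = 0) (hψt : IsTame ψ)
    {e : ℕ} (he : Nat.card T = p ^ e * Nat.card (perp ψ)) {m n : ℕ} (d : Fin m → ℤ)
    (a b : Fin n → ℤ) (hd : ∀ i, IsCoprime (d i) (p : ℤ))
    (hab : ∀ k, (p : ℤ) ∣ 2 * a k ∧ (p : ℤ) ∣ 2 * b k) :
    matSum ψ (blockForm d a b) =
      (legendreSym p (blockForm d a b).det : ℂ) ^ e * gaussSum ψ ^ (m + 2 * n) := by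
  have hprod : ∀ {k : ℕ} (c : Fin k → ℤ), legendreSym p (∏ i, c i) = ∏ i, legendreSym p (c i) :=
    fun c => map_prod (legendreSym.hom p) c _
  rw [matSum_blockForm, Finset.prod_congr rfl fun i _ =>
    gaussSum_smul_odd_prime ψ hodd hT hψ hψt he (hd i), Finset.prod_congr rfl fun k _ =>
    matSum_pseudoHyperbolic_of_odd ψ hodd hT hψ hψt he (hab k).1 (hab k).2, det_blockForm,
    legendreSym.mul, hprod, hprod]
  push_cast
  rw [Finset.prod_mul_distrib, Finset.prod_mul_distrib, Finset.prod_pow, Finset.prod_pow,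
    Finset.prod_const, Finset.prod_const, Finset.card_univ, Finset.card_univ, Fintype.card_fin,
    Fintype.card_fin, mul_pow, pow_add, pow_mul]
  ring

end OddFormula

/-! ### Invariance of `σ_2` and of the determinant class. -/

section Invariants

variable {ι : Type*} [Fintype ι] [DecidableEq ι]

theorem Similar.mono {p r s : ℕ} (h : s ≤ r) {A C : Matrix ι ι ℤ} (hs : Similar p r A C) :
    Similar p s A C := by
  obtain ⟨M, hM, hC⟩ := hs
  exact ⟨M, hM, fun i j => (hC i j).of_dvd (pow_dvd_pow _ h)⟩

theorem Similar.exists_det_modEq {p r : ℕ} {A C : Matrix ι ι ℤ} (hs : Similar p r A C) :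
    ∃ c : ℤ, IsCoprime c (p : ℤ) ∧ C.det ≡ c ^ 2 * A.det [ZMOD (p : ℤ) ^ r] := by
  obtain ⟨M, hM, hC⟩ := hs
  refine ⟨M.det, hM, ?_⟩
  have h1 : C.map (Int.castRingHom (ZMod (p ^ r))) =
      (M.transpose * A * M).map (Int.castRingHom (ZMod (p ^ r))) := by
    ext i j
    have := hC i j
    rw [← Nat.cast_pow, ← ZMod.intCast_eq_intCast_iff] at this
    exact this
  have h2 := congrArg Matrix.det h1
  rw [← RingHom.mapMatrix_apply, ← RingHom.mapMatrix_apply, ← RingHom.map_det,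
    ← RingHom.map_det, Matrix.det_mul, Matrix.det_mul, Matrix.det_transpose] at h2
  rw [← Nat.cast_pow, ← ZMod.intCast_eq_intCast_iff]
  have h3 : (C.det : ZMod (p ^ r)) = ((M.det * A.det * M.det : ℤ) : ZMod (p ^ r)) := h2
  rw [h3]
  congr 1
  ring

theorem isSymm_of_isReduced {ι : Type*} {C : Matrix ι ι ℤ} (hC : IsReduced C) : C.IsSymm := by
  obtain ⟨m, n, d, a, b, f, rfl⟩ := hC
  exact (blockForm_isSymm d a b).submatrix f

theorem isReduced_submatrix_blockForm {ι : Type*} {m n : ℕ} (d : Fin m → ℤ) (a b : Fin n → ℤ)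
    (f : ι ≃ Fin m ⊕ Fin 2 × Fin n) : IsReduced ((blockForm d a b).submatrix f f) :=
  ⟨m, n, d, a, b, f, rfl⟩

/-- The weights `1, -1, 3, -3` reproduce an odd residue modulo `8`, and the even diagonal entries of
the pseudo-hyperbolics are not counted. -/
theorem diagSigma_submatrix_blockForm {ι : Type*} [Fintype ι] {m n : ℕ} (d : Fin m → ℤ) (a b : Fin n → ℤ)
    (f : ι ≃ Fin m ⊕ Fin 2 × Fin n) (hd : ∀ i, d i % 2 = 1) :
    diagSigma ((blockForm d a b).submatrix f f) = ∑ i, (d i : ZMod 8) := by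
  let φ : ℤ → ZMod 8 := fun x => (if x ≡ 1 [ZMOD 8] then 1 else 0) -
    (if x ≡ -1 [ZMOD 8] then 1 else 0) + 3 * (if x ≡ 3 [ZMOD 8] then 1 else 0) -
    3 * (if x ≡ -3 [ZMOD 8] then 1 else 0)
  have h1 : ∀ C : Matrix ι ι ℤ, diagSigma C = ∑ i, φ (C i i) := by
    intro C
    simp only [diagSigma, diagCount, φ, Finset.sum_add_distrib, Finset.sum_sub_distrib,
      ← Finset.mul_sum, Finset.sum_boole]
  have hodd : ∀ x : ℤ, x % 2 = 1 → φ x = x := by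
    intro x hx
    have h8 : x % 8 = 1 ∨ x % 8 = 3 ∨ x % 8 = 5 ∨ x % 8 = 7 := by omega
    have hc : (x : ZMod 8) = ((x % 8 : ℤ) : ZMod 8) := by
      rw [ZMod.intCast_eq_intCast_iff]
      exact (Int.mod_modEq x 8).symm
    rw [hc]
    rcases h8 with h | h | h | h <;> simp only [φ, Int.ModEq, h] <;> decide
  have heven : ∀ x : ℤ, φ (2 * x) = 0 := by
    intro x
    have h1 : ¬ (2 * x ≡ 1 [ZMOD 8]) := by unfold Int.ModEq; omega
    have h2 : ¬ (2 * x ≡ -1 [ZMOD 8]) := by unfold Int.ModEq; omega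
    have h3 : ¬ (2 * x ≡ 3 [ZMOD 8]) := by unfold Int.ModEq; omega
    have h4 : ¬ (2 * x ≡ -3 [ZMOD 8]) := by unfold Int.ModEq; omega
    simp [φ, h1, h2, h3, h4]
  rw [h1]
  simp only [Matrix.submatrix_apply]
  rw [Equiv.sum_comp f fun i => φ (blockForm d a b i i), Fintype.sum_sum_type]
  have h2 : ∀ z : Fin 2 × Fin n, φ (blockForm d a b (Sum.inr z) (Sum.inr z)) = 0 := by
    rintro ⟨i, k⟩
    fin_cases i
    · simpa [blockForm, Matrix.blockDiagonal_apply] using heven (a k)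
    · simpa [blockForm, Matrix.blockDiagonal_apply] using heven (b k)
  rw [Finset.sum_eq_zero fun z _ => h2 z, add_zero]
  refine Finset.sum_congr rfl fun i _ => ?_
  rw [← hodd _ (hd i)]
  simp [blockForm]

theorem diag_odd_of_isCoprime_det {m n : ℕ} {d : Fin m → ℤ} {a b : Fin n → ℤ}
    (h : IsCoprime (blockForm d a b).det 2) (i : Fin m) : d i % 2 = 1 := by
  rw [det_blockForm] at h
  rw [← isCoprime_two_iff]
  exact IsCoprime.prod_left_iff.mp h.of_mul_left_left i (Finset.mem_univ i)

/-- The squares modulo `8` are `0, 1, 4, 1, 0, 1, 4, 1`; the terms for `0` and `4` cancel. -/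
theorem gaussSum_standardQuadratic_eight :
    gaussSum (standardQuadratic 8) = 4 * (ZMod.toCircle (1 : ZMod 8) : ℂ) := by
  let F : ZMod 8 → ℂ := fun x => (ZMod.toCircle x : ℂ)
  have h0 : F 0 = 1 := by simp [F]
  have h4 : F 4 = -1 := by
    have h1 : F 4 * F 4 = 1 := by
      rw [← h0, show (0 : ZMod 8) = 4 + 4 by decide]
      simp only [F]
      rw [AddChar.map_add_eq_mul, Circle.coe_mul]
    have h2 : F 4 ≠ 1 := by
      intro h
      have h3 : ZMod.toCircle (4 : ZMod 8) = ZMod.toCircle (0 : ZMod 8) := by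
        rw [AddChar.map_zero_eq_one]
        exact Circle.coe_eq_one.mp h
      exact absurd (ZMod.injective_toCircle h3) (by decide)
    exact (mul_self_eq_one_iff.mp h1).resolve_left h2
  have hsum : gaussSum (standardQuadratic 8) = ∑ x : ZMod 8, F (x * x) := by
    rw [gaussSum_eq_sum]
    rfl
  rw [hsum]
  have : ∑ x : ZMod 8, F (x * x) =
      F 0 + F 1 + F 4 + F 1 + F 0 + F 1 + F 4 + F 1 := Fin.sum_univ_eight _
  rw [this, h0, h4]
  ring

theorem two_pow_three_smul_zmod (x : ZMod 8) : ((2 : ℕ) : ℤ) ^ 3 • x = 0 := by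
  simpa using smul_zmod_eq_zero 8 x

theorem two_pow_three_smul_standardQuadratic (x : ZMod 8) :
    ((2 : ℕ) : ℤ) ^ 3 • standardQuadratic 8 x = 0 := by
  have := smul_standardQuadratic 8 x
  norm_num at this ⊢
  exact this

theorem isTame_standardQuadratic_eight : IsTame (standardQuadratic 8) := by
  intro t ht
  rw [mem_perp_standardQuadratic] at ht
  have h : ∀ x : ZMod 8, 2 * x = 0 → x * x = 0 := by decide
  rw [standardQuadratic_apply, h t ht, map_zero]

/-- Read off from the absolute value: `16 = 8 * 2`. Hence `e = 2` for this function. -/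
theorem card_perp_standardQuadratic_eight : Nat.card (perp (standardQuadratic 8)) = 2 := by
  have := norm_gaussSum_sq _ isTame_standardQuadratic_eight
  rw [gaussSum_standardQuadratic_eight, norm_mul, Circle.norm_coe, Nat.card_zmod] at this
  norm_num at this
  have h2 : (Nat.card (perp (standardQuadratic 8)) : ℝ) = 2 := by linarith
  exact_mod_cast h2

/-- The quadratic function `x² / 8` on `ℤ / 8` detects `diagSigma`. -/
theorem direction_matSum_standardQuadratic_eight {C : Matrix ι ι ℤ} (hC : IsReduced C)
    (hdet : IsCoprime C.det 2) :
    direction (matSum (standardQuadratic 8) C) = (ZMod.toCircle (diagSigma C) : ℂ) := by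
  obtain ⟨m, n, d, a, b, f, hf⟩ := hC
  change C = (blockForm d a b).submatrix f f at hf
  subst hf
  rw [Matrix.det_submatrix_equiv_self] at hdet
  have hd := diag_odd_of_isCoprime_det hdet
  have h := (direction_matSum_blockForm_two (standardQuadratic 8)
    two_pow_three_smul_zmod two_pow_three_smul_standardQuadratic
    isTame_standardQuadratic_eight (e := 2)
    (by rw [card_perp_standardQuadratic_eight]; simp) d a b hd).2
  have hsq := signEight_sq ((isCoprime_two_iff _).mp hdet)
  rw [matSum_submatrix _ (blockForm_isSymm d a b), h, hsq, mul_one,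
    diagSigma_submatrix_blockForm d a b f hd, gaussSum_standardQuadratic_eight, direction,
    norm_mul, Circle.norm_coe, mul_one]
  norm_num
  rw [← Circle.coe_zpow, ← AddChar.map_zsmul_eq_zpow]
  simp

theorem isCoprime_det_of_similar {p r : ℕ} (hr : r ≠ 0) {A C : Matrix ι ι ℤ}
    (h : Similar p r A C) (hA : IsCoprime A.det (p : ℤ)) : IsCoprime C.det (p : ℤ) := by
  obtain ⟨c, hc, hcd⟩ := h.exists_det_modEq
  rw [← isUnit_intCast_zmod_pow hr] at hA hc ⊢
  rw [← Nat.cast_pow, ← ZMod.intCast_eq_intCast_iff] at hcd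
  rw [hcd, Int.cast_mul, Int.cast_pow]
  exact (hc.pow 2).mul hA

/-- Both reduced matrices have the Gauss sum of `A` for `x^2 / 8`, and its direction recovers the
invariant because the character `ZMod.toCircle` is injective. -/
theorem diagSigma_eq_of_similar {A C C' : Matrix ι ι ℤ} (hA : A.IsSymm)
    (hdet : IsCoprime A.det 2) (hC : IsReduced C) (hC' : IsReduced C')
    (h : Similar 2 3 A C) (h' : Similar 2 3 A C') : diagSigma C = diagSigma C' := by
  have h1 := matSum_eq_of_similar (standardQuadratic 8)
    two_pow_three_smul_zmod two_pow_three_smul_standardQuadratic hA (isSymm_of_isReduced hC) h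
  have h2 := matSum_eq_of_similar (standardQuadratic 8)
    two_pow_three_smul_zmod two_pow_three_smul_standardQuadratic hA (isSymm_of_isReduced hC') h'
  have h3 := congrArg direction (h1.symm.trans h2)
  rw [direction_matSum_standardQuadratic_eight hC (isCoprime_det_of_similar three_ne_zero h hdet),
    direction_matSum_standardQuadratic_eight hC'
      (isCoprime_det_of_similar three_ne_zero h' hdet)] at h3
  exact ZMod.injective_toCircle (Circle.coe_injective h3)

theorem sigma_two_eq_diagSigma {A C : Matrix ι ι ℤ} (hA : A.IsSymm)
    (hdet : IsCoprime A.det 2) (hC : IsReduced C) (h : Similar 2 3 A C) :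
    sigma 2 A = diagSigma C := by
  have hex : ∃ C, IsReduced C ∧ Similar 2 3 A C := ⟨C, hC, h⟩
  rw [sigma, if_pos rfl, dif_pos hex]
  exact diagSigma_eq_of_similar hA hdet hex.choose_spec.1 hC hex.choose_spec.2 h

theorem neg_one_pow_epsilon_two {a : ℤ} (ha : a % 2 = 1) :
    (-1) ^ epsilon 2 a = signEight a := by
  have hc : (a : ZMod 8) = ((a % 8 : ℤ) : ZMod 8) := by
    rw [ZMod.intCast_eq_intCast_iff]
    exact (Int.mod_modEq a 8).symm
  have h8 : a % 8 = 1 ∨ a % 8 = 3 ∨ a % 8 = 5 ∨ a % 8 = 7 := by omega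
  rw [epsilon, if_pos rfl, signEight, hc]
  rcases h8 with h | h | h | h
  · rw [if_pos (by unfold Int.ModEq; omega), h]; decide
  · rw [if_neg (by unfold Int.ModEq; omega), h]; decide
  · rw [if_neg (by unfold Int.ModEq; omega), h]; decide
  · rw [if_pos (by unfold Int.ModEq; omega), h]; decide

theorem neg_one_pow_epsilon_odd {p : ℕ} [Fact p.Prime] (hodd : p ≠ 2) {a : ℤ}
    (ha : IsCoprime a (p : ℤ)) : (-1) ^ epsilon p a = legendreSym p a := by
  have ha0 : (a : ZMod p) ≠ 0 := by
    rw [Ne, ZMod.intCast_zmod_eq_zero_iff_dvd, ← not_isCoprime_iff_dvd Fact.out, not_not]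
    exact ha
  rw [epsilon, if_neg hodd]
  split_ifs with h
  · rw [(legendreSym.eq_one_iff p ha0).mpr h, pow_zero]
  · rw [legendreSym_eq_neg_one_of_not_isSquare h, pow_one]

theorem exists_pow_smul_eq_zero {p : ℕ} (hp : p.Prime) {T : Type*} [AddCommGroup T] [Finite T]
    (hT : IsPGroup p (Multiplicative T)) (ψ : QuadraticMap ℤ T UnitAddCircle) :
    ∃ r, 3 ≤ r ∧ (∀ x : T, (p : ℤ) ^ r • x = 0) ∧ ∀ x : T, (p : ℤ) ^ r • ψ x = 0 := by
  have : Fact p.Prime := ⟨hp⟩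
  obtain ⟨k, hk⟩ := IsPGroup.iff_card.mp hT
  have hk' : ∀ x : T, (p : ℤ) ^ k • x = 0 := by
    intro x
    have h : Nat.card T = p ^ k := hk
    have := card_nsmul_eq_zero' (x := x)
    rw [h, ← natCast_zsmul] at this
    exact_mod_cast this
  -- Since `ψ(p^k x) = p^(2k) ψ(x)`, the values need twice the exponent of `T`; the extra `3`
  -- ensures that `2^r`-similarity implies `8`-similarity.
  refine ⟨k + k + 3, by omega, fun x => ?_, fun x => ?_⟩
  · rw [add_assoc, add_comm, pow_add, mul_smul, hk', smul_zero]
  · have := ψ.map_smul ((p : ℤ) ^ k) x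
    rw [hk', QuadraticMap.map_zero] at this
    rw [add_comm, pow_add, mul_smul, pow_add, ← this, smul_zero]

end Invariants

theorem phase_eq_of_direction {S T : Type*} [Finite S] [Finite T] {f : S → UnitAddCircle}
    {g : T → UnitAddCircle} (hf : gaussSum f ≠ 0) (hg : gaussSum g ≠ 0) {s : ℤ} {ε e : ℕ}
    (h : direction (gaussSum f) = direction (gaussSum g) ^ s * ((-1) ^ ε) ^ e) :
    phase f = s • phase g + (((ε * e : ℝ) / 2 : ℝ) : UnitAddCircle) := by
  apply AddCircle.injective_toCircle one_ne_zero
  apply Circle.coe_injective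
  rw [toCircle_phase hf, h, AddCircle.toCircle_add, AddCircle.toCircle_zsmul, Circle.coe_mul,
    Circle.coe_zpow, toCircle_phase hg, AddCircle.toCircle_apply_mk, Circle.coe_exp]
  congr 1
  have : ((2 * Real.pi / 1 * ((ε * e : ℝ) / 2) : ℝ) : ℂ) * Complex.I =
      ((ε * e : ℕ) : ℂ) * (Real.pi * Complex.I) := by
    push_cast
    ring
  rw [this, Complex.exp_nat_mul, Complex.exp_pi_mul_I, pow_mul]

end GaussSum

end

/-! ### The theorem. -/

open GaussSum in
theorem theorem2p8 (p : ℕ) (hp : p.Prime)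
    {T : Type*} [AddCommGroup T] [Finite T] (hT : IsPGroup p (Multiplicative T))
    (ψ : QuadraticMap ℤ T UnitAddCircle) (hψ : IsTame ψ)
    (e : ℕ) (he : Nat.card (T ⧸ perp ψ) = p ^ e)
    {V : Type*} [AddCommGroup V] [Module.Free ℤ V] [Module.Finite ℤ V]
    (B : LinearMap.BilinForm ℤ V) (hB : B.IsSymm)
    {ι : Type*} [Fintype ι] [DecidableEq ι] (v : Module.Basis ι ℤ V)
    (hdet : IsCoprime (LinearMap.BilinForm.toMatrix v B).det (p : ℤ)) :
    -- for `p = 2` the integer `σ_2(B)` modulo `8` is well defined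
    (p = 2 →
      (∃ C, IsReduced C ∧ Similar 2 3 (LinearMap.BilinForm.toMatrix v B) C) ∧
      ∀ C, IsReduced C → Similar 2 3 (LinearMap.BilinForm.toMatrix v B) C →
        sigma 2 (LinearMap.BilinForm.toMatrix v B) = diagSigma C) ∧
    -- both phases are defined
    gaussSum ψ ≠ 0 ∧ gaussSum (tensorQuadratic B ψ) ≠ 0 ∧
    -- the formula, for every integer `s` that represents `σ_p(B)` modulo `8`
    ∀ s : ℤ, (s : ZMod 8) = sigma p (LinearMap.BilinForm.toMatrix v B) →
      phase (tensorQuadratic B ψ) = s • phase ψ +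
        (((epsilon p (LinearMap.BilinForm.toMatrix v B).det * e : ℝ) / 2 : ℝ) :
          UnitAddCircle) := by
  have hfact : Fact p.Prime := ⟨hp⟩
  obtain ⟨r, hr3, hTr, hψr⟩ := exists_pow_smul_eq_zero hp hT ψ
  have hr0 : r ≠ 0 := by omega
  have he' : Nat.card T = p ^ e * Nat.card (perp ψ) := by
    rw [← he]
    exact AddSubgroup.card_eq_card_quotient_mul_card_addSubgroup _
  have hG := gaussSum_ne_zero ψ hψ
  have hsum := gaussSum_tensorQuadratic_eq_matSum ψ B hB v
  have hA : (LinearMap.BilinForm.toMatrix v B).IsSymm := by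
    ext i j
    simp [Matrix.transpose_apply, LinearMap.BilinForm.toMatrix_apply, hB.eq (v j) (v i)]
  generalize LinearMap.BilinForm.toMatrix v B = A at *
  obtain ⟨m, n, d, a, b, f, hd, hab, hs⟩ := exists_similar_blockForm hp hr0 hA hdet
  have hD := blockForm_isSymm d a b
  have hsum' : gaussSum (tensorQuadratic B ψ) = matSum ψ (blockForm d a b) := by
    rw [hsum, matSum_eq_of_similar ψ hTr hψr hA (hD.submatrix f) hs, matSum_submatrix ψ hD f]
  obtain ⟨c, hc, hcd⟩ := hs.exists_det_modEq
  rw [Matrix.det_submatrix_equiv_self] at hcd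
  by_cases h2 : p = 2
  · subst h2
    have hs3 := hs.mono hr3
    have hred := isReduced_submatrix_blockForm d a b f
    have hσ := fun C (hC : IsReduced C) (h : Similar 2 3 A C) =>
      sigma_two_eq_diagSigma hA hdet hC h
    have hd' : ∀ i, d i % 2 = 1 := fun i => (isCoprime_two_iff _).mp (hd i)
    have hmain := direction_matSum_blockForm_two ψ hTr hψr hψ he' d a b hd'
    rw [← hsum'] at hmain
    refine ⟨fun _ => ⟨⟨_, hred, hs3⟩, hσ⟩, hG, hmain.1, fun s hs => ?_⟩
    refine phase_eq_of_direction hmain.1 hG ?_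
    have hmod : ∑ i, d i ≡ s [ZMOD 8] := by
      refine (ZMod.intCast_eq_intCast_iff _ _ 8).mp ?_
      rw [hs, hσ _ hred hs3, diagSigma_submatrix_blockForm d a b f hd']
      push_cast
      rfl
    -- Similarity changes the determinant by the square of an odd number, which is `1` modulo `8`.
    have hsign : signEight (blockForm d a b).det = signEight A.det := by
      have h8 : (blockForm d a b).det ≡ c ^ 2 * A.det [ZMOD 8] :=
        hcd.of_dvd (pow_dvd_pow 2 hr3)
      have hc2 := (isCoprime_two_iff c).mp hc
      have hcc : ∀ x : ZMod 8, (2 * x + 1) ^ 2 = 1 := by decide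
      have hc8 : (c : ZMod 8) ^ 2 = 1 := by
        have := hcc ((c / 2 : ℤ) : ZMod 8)
        have h3 : c = 2 * (c / 2) + 1 := by omega
        rw [h3]
        push_cast
        exact this
      have := (ZMod.intCast_eq_intCast_iff _ _ 8).mpr h8
      rw [signEight, signEight, this]
      push_cast
      rw [hc8, one_mul]
    have hε := neg_one_pow_epsilon_two ((isCoprime_two_iff _).mp hdet)
    rw [hmain.2, hsign, ← hε, zpow_eq_zpow_of_modEq (direction_pow_eight ψ hTr hψr hG) hmod]
    push_cast
    rfl
  · have hmain := matSum_blockForm_of_odd ψ h2 hTr hψr hψ he' d a b hd hab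
    have hε := neg_one_pow_epsilon_odd h2 hdet
    have hleg : legendreSym p (blockForm d a b).det = legendreSym p A.det := by
      have hmod := hcd.of_dvd (dvd_pow_self (p : ℤ) hr0)
      rw [legendreSym.mod p (blockForm d a b).det, hmod, ← legendreSym.mod, legendreSym.mul,
        legendreSym.sq_one', one_mul]
      rw [Ne, ZMod.intCast_zmod_eq_zero_iff_dvd, ← not_isCoprime_iff_dvd hp, not_not]
      exact hc
    rw [← hsum', hleg, ← hε] at hmain
    push_cast at hmain
    have hne : gaussSum (tensorQuadratic B ψ) ≠ 0 := by
      rw [hmain]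
      exact mul_ne_zero (pow_ne_zero _ (pow_ne_zero _ (by norm_num))) (pow_ne_zero _ hG)
    refine ⟨fun h => absurd h h2, hG, hne, fun s hs' => phase_eq_of_direction hne hG ?_⟩
    -- A determinant prime to `p` is nonzero, so the rank is the size `m + 2n`, the exponent of
    -- `G(ψ)` in `hmain`.
    have hA0 : A.det ≠ 0 := by
      intro h
      rw [h, isCoprime_zero_left] at hdet
      exact hp.ne_one (by simpa using Int.isUnit_iff_natAbs_eq.mp hdet)
    have hcard : Fintype.card ι = m + 2 * n := by
      rw [Fintype.card_congr f]
      simp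
    have hmod : s ≡ ((m + 2 * n : ℕ) : ℤ) [ZMOD 8] := by
      refine (ZMod.intCast_eq_intCast_iff _ _ 8).mp ?_
      rw [hs', sigma, if_neg h2, Matrix.rank_of_det_ne_zero hA0, hcard]
      simp
    rw [hmain, direction_mul, direction_pow, direction_pow, direction_pow,
      zpow_eq_zpow_of_modEq (direction_pow_eight_of_odd ψ h2 hTr hψr hG) hmod, zpow_natCast,
      mul_comm]
    congr 3
    simp [direction]
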